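/- **Setting.** Let $L\ge 0$, $u=2^L$ and $U=\{0,\dots,u-1\}$. For bit-strings $\alpha,\beta$ let $\alpha\oplus\beta$ be what remains of $\beta$ after removing the longest common prefix of $\alpha$ and $\beta$. For a finite set $T$ of bit-strings $\gamma_1\prec\dots\prec\gamma_m$ (lexicographic order) let $\mathrm{trie}(T)=|\gamma_1|+\sum_{j=2}^m|\gamma_{j-1}\oplus\gamma_j|$, with $\mathrm{trie}(\emptyset)=0$. For $S\subseteq U$ and $a\in U$ let $S+a$ be the set of the $L$-bit binary representations (most significant bit first) of the numbers $(x+a)\bmod u$, $x\in S$; for a sequence $\mathcal S=\langle S_1,\dots,S_n\rangle$ of subsets of $U$ let $\mathrm{trie}(\mathcal S+a)=\sum_{i=1}^n\mathrm{trie}(S_i+a)$, and let $N=\sum_{i=1}^n|S_i|$. The model of computation is the word RAM: registers and finitely many zero-initialised arrays of $w$-bit words, with unit-cost constants, register and array accesses, tests and the operations $+,-,\times$, integer division, remainder and comparison on words. A *DAG-compressed segment tree* for an array $A[0..2^h)$ is an acyclic graph of nodes, each with fields $\mathrm{val},\min,\mathrm{argmin}$ and, unless it is a leaf, pointers $\mathrm{left},\mathrm{right}$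 (different pointers may lead to the same node), whose expansion from the root is a complete binary tree with $2^h$ leaves, such that $A[a]$ is the sum of the $\mathrm{val}$ fields on the path from the root to the $a$-th leaf, and such that $\min$ and $\mathrm{argmin}$ of every node hold the minimum, and a (relative) position of it, of the sequence of the sums of the $\mathrm{val}$ fields from that node down to the leaves below it. **Theorem.** There are constants $C,c$ such that the following holds. 1. *(Data structure.)* There are word-RAM programs for the following operations on arrays stored as DAG-compressed segment trees. *Initialize* creates the array $\langle 0\rangle$ of length $1$ in at most $C$ steps. On an array $A$ of length $2^h$: *add*$(\ell,r)$, for $0\le\ell\le r\le 2^h$, increments $A[a]$ by one for all $a\in[\ell,r)$ in at most $C(h+1)$ steps; *extend* replaces $A$ by $AA$ in at most $C$ steps; *argmin* returns the $\mathrm{argmin}$ field of the root, which is a position of a minimum of $A$, in at most $C$ steps. Here *add* allocates at most $C(h+1)$ new nodes and *extend* at most $C$, and it is assumed that the words have room for the next operation: $2^w$ is at least the number of nodes allocated so far plus $C(h+1)$, at least $C\,2^h$, and larger than $A[a]+1$ for every $a$. 2. *(Optimal shift.)* There is one word-RAM program which, for all $L$, $n$ and every sequence $\mathcal S$ of $n$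 subsets of $U$, given $u$, $n$, the sizes $|S_1|,\dots,|S_n|$ and the concatenation of listings of $S_1,\dots,S_n$ (each without repetition, in any order), and for every word size $w$ with $2^w\ge(u+n+N+1)^c$, halts and returns an $a\in U$ that minimizes $\mathrm{trie}(\mathcal S+a)$ over $U$. It makes at most $C(N\log^2u+n+1)$ steps; if $u\ge2$, $n\ge1$ and all $S_i$ are non-empty, it makes at most $C\,N\log^2u$ steps, so that the running time is $O(N\log^2u)$ with no linear dependence on $u$. In this case, moreover, when the program halts, its memory holds a DAG-compressed segment tree for the array $\big(\mathrm{trie}(\mathcal S+a)\big)_{0\le a<u}$, and the returned shift is the $\mathrm{argmin}$ field of its root. -/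

import Mathlib

namespace ShiftTrie

/-! ### Bit-strings, the trie measure, shifted encodings -/

/-- `oplus α β` is what remains of `β` once the longest common prefix of `α` and `β` is removed. -/
def oplus : List Bool → List Bool → List Bool
  | a :: α, b :: β => if a = b then oplus α β else b :: β
  | _, β => β

/-- `|γ₁ ⊕ γ₂| + |γ₂ ⊕ γ₃| + ⋯` for a list `γ₁, γ₂, γ₃, …` of bit-strings. -/
def sumOplus : List (List Bool) → ℕ
  | α :: β :: l => (oplus α β).length + sumOplus (β :: l)
  | _ => 0

/-- `|γ₁| + ∑ |γ_{j-1} ⊕ γ_j|` for a list of bit-strings (`0` for the empty list). -/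
def listTrie : List (List Bool) → ℕ
  | [] => 0
  | α :: l => α.length + sumOplus (α :: l)

/-- The trie measure of a finite set of bit-strings: the strings are taken in increasing
lexicographic order (the order `≤` on `List Bool`, with `false < true`). -/
def trie (T : Finset (List Bool)) : ℕ := listTrie (T.sort (· ≤ ·))

/-- The `L`-bit binary representation of `x`, most significant bit first. -/
def bits : ℕ → ℕ → List Bool
  | 0, _ => []
  | L + 1, x => x.testBit L :: bits L x

/-- The shifted encoding of the universe `{0, …, 2 ^ L - 1}`. -/
def shiftEnc (L a x : ℕ) : List Bool := bits L ((x + a) % 2 ^ L)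

/-- The shifted trie measure `trie(𝒮 + a)` of a sequence `𝒮` of subsets of `{0, …, 2 ^ L - 1}`. -/
def shiftTrie (L : ℕ) {n : ℕ} (S : Fin n → Finset ℕ) (a : ℕ) : ℕ :=
  ∑ i, trie ((S i).image (shiftEnc L a))

/-! ### The word RAM

The machine has registers and finitely many (as many as the program mentions) arrays of words.
With word size `w` every computed value is reduced modulo `2 ^ w`, so that every address is a word
as well. A program is a structured command; each operation, constant, register or memory access,
and test costs one time unit. -/

/-- A memory state: `reg r` is the content of register `r`, and `mem A i` is cell `i` of
array `A`. -/
structure State where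
  reg : ℕ → ℕ
  mem : ℕ → ℕ → ℕ

/-- The binary machine operations; comparisons return `1` (true) or `0` (false). -/
inductive Op where
  | add | sub | mul | div | mod | lt | le | eq

/-- Subtraction is truncated at `0`. -/
def Op.apply : Op → ℕ → ℕ → ℕ
  | .add, x, y => x + y
  | .sub, x, y => x - y
  | .mul, x, y => x * y
  | .div, x, y => x / y
  | .mod, x, y => x % y
  | .lt, x, y => if x < y then 1 else 0
  | .le, x, y => if x ≤ y then 1 else 0
  | .eq, x, y => if x = y then 1 else 0

inductive Expr where
  | const (v : ℕ)
  | reg (r : ℕ)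
  | load (A : ℕ) (i : Expr)
  | bin (o : Op) (e f : Expr)

def Expr.eval (w : ℕ) (σ : State) : Expr → ℕ
  | .const v => v % 2 ^ w
  | .reg r => σ.reg r
  | .load A i => σ.mem A (i.eval w σ)
  | .bin o e f => o.apply (e.eval w σ) (f.eval w σ) % 2 ^ w

/-- The time for evaluating an expression: its number of symbols. -/
def Expr.cost : Expr → ℕ
  | .const _ => 1
  | .reg _ => 1
  | .load _ i => i.cost + 1
  | .bin _ e f => e.cost + f.cost + 1

inductive Cmd where
  | skip
  | assign (r : ℕ) (e : Expr)
  | store (A : ℕ) (i e : Expr)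
  | seq (c d : Cmd)
  | ite (b : Expr) (c d : Cmd)
  | while (b : Expr) (c : Cmd)

def State.setReg (σ : State) (r v : ℕ) : State :=
  { σ with reg := Function.update σ.reg r v }

def State.setMem (σ : State) (A i v : ℕ) : State :=
  { σ with mem := Function.update σ.mem A (Function.update (σ.mem A) i v) }

/-- `Exec w c σ t τ`: on a machine with words of `w` bits, the command `c` started in state `σ`
halts in state `τ` after exactly `t` time units. -/
inductive Exec (w : ℕ) : Cmd → State → ℕ → State → Prop
  | skip (σ : State) : Exec w .skip σ 1 σ
  | assign (r : ℕ) (e : Expr) (σ : State) :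
      Exec w (.assign r e) σ (e.cost + 1) (σ.setReg r (e.eval w σ))
  | store (A : ℕ) (i e : Expr) (σ : State) :
      Exec w (.store A i e) σ (i.cost + e.cost + 1) (σ.setMem A (i.eval w σ) (e.eval w σ))
  | seq {c d : Cmd} {σ τ ρ : State} {s t : ℕ} (hc : Exec w c σ s τ) (hd : Exec w d τ t ρ) :
      Exec w (.seq c d) σ (s + t) ρ
  | iteTrue {b : Expr} {c d : Cmd} {σ τ : State} {t : ℕ} (hb : b.eval w σ ≠ 0)
      (hc : Exec w c σ t τ) : Exec w (.ite b c d) σ (b.cost + 1 + t) τ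
  | iteFalse {b : Expr} {c d : Cmd} {σ τ : State} {t : ℕ} (hb : b.eval w σ = 0)
      (hd : Exec w d σ t τ) : Exec w (.ite b c d) σ (b.cost + 1 + t) τ
  | whileTrue {b : Expr} {c : Cmd} {σ τ ρ : State} {s t : ℕ} (hb : b.eval w σ ≠ 0)
      (hc : Exec w c σ s τ) (hl : Exec w (.while b c) τ t ρ) :
      Exec w (.while b c) σ (b.cost + 1 + s + t) ρ
  | whileFalse {b : Expr} {c : Cmd} {σ : State} (hb : b.eval w σ = 0) :
      Exec w (.while b c) σ (b.cost + 1) σ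

/-! ### Input and output conventions -/

/-- The register that holds the result. -/
abbrev outReg : ℕ := 0

/-- The initial state for the universe `{0, …, 2 ^ L - 1}` and the sequence of sets whose `i`-th
member is listed (in any order) by `l i`: register 1 holds the size of the universe, register 2 the
number of sets, array 0 the sizes of the sets, array 1 the concatenation of the listings; everything
else is `0`. -/
def inputState (L : ℕ) {n : ℕ} (l : Fin n → List ℕ) : State where
  reg r := if r = 1 then 2 ^ L else if r = 2 then n else 0
  mem A j :=
    if A = 0 then (if h : j < n then (l ⟨j, h⟩).length else 0)
    else if A = 1 then (List.ofFn l).flatten.getD j 0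
    else 0

/-! ### DAG-compressed segment trees

A node is a number `p`; its fields are the cells of index `p` of five arrays. Different pointers may
lead to the same node, so that the tree of height `h` is stored as a DAG. Nodes are allocated
consecutively: those in use lie below the content of `freeReg`. -/

/-- The registers with the arguments `ℓ` and `r` of a range update. -/
abbrev loReg : ℕ := 1
abbrev hiReg : ℕ := 2

/-- The registers with the root, the first free node, and the height of the structure. -/
abbrev rootReg : ℕ := 3
abbrev freeReg : ℕ := 4
abbrev heightReg : ℕ := 5

/-- The arrays with the five fields of the nodes. -/
abbrev valArr : ℕ := 2
abbrev minArr : ℕ := 3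
abbrev argminArr : ℕ := 4
abbrev leftArr : ℕ := 5
abbrev rightArr : ℕ := 6

/-- The node `p` is the root of a DAG whose expansion is a complete binary tree with `2 ^ h` leaves
representing the sequence `A[0 .. 2 ^ h)`: `A[a]` is the sum of the `val` fields on the path to the
`a`-th leaf, and every node holds the minimum of the sequence represented below it, together with a
position where it is attained. Every node `q` that is reached has the height `ht q`, so that there
are no cycles. -/
def IsDag (σ : State) (ht : ℕ → ℕ) : ℕ → ℕ → (ℕ → ℕ) → Prop
  | 0, p, A =>
      p < σ.reg freeReg ∧ ht p = 0 ∧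
      σ.mem valArr p = A 0 ∧ σ.mem minArr p = A 0 ∧ σ.mem argminArr p = 0
  | h + 1, p, A =>
      p < σ.reg freeReg ∧ ht p = h + 1 ∧
      σ.mem argminArr p < 2 ^ (h + 1) ∧ A (σ.mem argminArr p) = σ.mem minArr p ∧
      (∀ a < 2 ^ (h + 1), σ.mem minArr p ≤ A a) ∧
      (∀ a < 2 ^ (h + 1), σ.mem valArr p ≤ A a) ∧
      IsDag σ ht h (σ.mem leftArr p) (fun a => A a - σ.mem valArr p) ∧
      IsDag σ ht h (σ.mem rightArr p) (fun a => A (2 ^ h + a) - σ.mem valArr p)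

/-- The state `σ` stores the sequence `A[0 .. 2 ^ h)` as a DAG-compressed segment tree. -/
def Stores (σ : State) (h : ℕ) (A : ℕ → ℕ) : Prop :=
  σ.reg heightReg = h ∧ ∃ ht : ℕ → ℕ, IsDag σ ht h (σ.reg rootReg) A

/-- The words of `w` bits have room for the next operation on `A[0 .. 2 ^ h)`: for `C * (h + 1)` new
nodes, for the positions up to `C * 2 ^ h`, and for entries incremented by one. -/
def HasRoom (w C : ℕ) (σ : State) (h : ℕ) (A : ℕ → ℕ) : Prop :=
  σ.reg freeReg + C * (h + 1) ≤ 2 ^ w ∧ C * 2 ^ h ≤ 2 ^ w ∧ ∀ a < 2 ^ h, A a + 1 < 2 ^ w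

/-- `cInit`, `cAdd`, `cExt`, `cArg` implement the operations initialize, add, extend and argmin on
sequences stored as DAG-compressed segment trees: initialize, extend and argmin take at most `C`
time units, and add takes at most `C * (h + 1)` of them on a sequence of length `2 ^ h`. -/
def Implements (C : ℕ) (cInit cAdd cExt cArg : Cmd) : Prop :=
  (∀ (w : ℕ) (σ : State), C ≤ 2 ^ w →
    ∃ t τ, Exec w cInit σ t τ ∧ t ≤ C ∧ Stores τ 0 (fun _ => 0) ∧ τ.reg freeReg ≤ C) ∧
  (∀ (w : ℕ) (σ : State) (h : ℕ) (A : ℕ → ℕ), Stores σ h A → HasRoom w C σ h A →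
    σ.reg loReg ≤ σ.reg hiReg → σ.reg hiReg ≤ 2 ^ h →
    ∃ t τ, Exec w cAdd σ t τ ∧ t ≤ C * (h + 1) ∧
      Stores τ h (fun a => if σ.reg loReg ≤ a ∧ a < σ.reg hiReg then A a + 1 else A a) ∧
      τ.reg freeReg ≤ σ.reg freeReg + C * (h + 1)) ∧
  (∀ (w : ℕ) (σ : State) (h : ℕ) (A : ℕ → ℕ), Stores σ h A → HasRoom w C σ h A →
    ∃ t τ, Exec w cExt σ t τ ∧ t ≤ C ∧
      Stores τ (h + 1) (fun a => A (a % 2 ^ h)) ∧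
      τ.reg freeReg ≤ σ.reg freeReg + C) ∧
  (∀ (w : ℕ) (σ : State) (h : ℕ) (A : ℕ → ℕ), Stores σ h A → HasRoom w C σ h A →
    ∃ t τ, Exec w cArg σ t τ ∧ t ≤ C ∧
      Stores τ h A ∧ τ.reg freeReg = σ.reg freeReg ∧
      τ.reg outReg = σ.mem argminArr (σ.reg rootReg) ∧
      τ.reg outReg < 2 ^ h ∧ ∀ a < 2 ^ h, A (τ.reg outReg) ≤ A a)

end ShiftTrie

/-!
The proof consists of two programs and their analysis.

**Range updates by splicing.** A range update on `[ℓ, r)` uses one operation on persistent trees.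
Given trees for two sequences of length `2 ^ h`, *splicing* them at `pos` makes a tree for the
sequence that agrees with the first one before `pos` and with the second one from `pos` on. It needs
one path of new nodes, each with `val = 0`, towards the leaf `pos`; each sibling of the path is a
copy of a node of the first or of the second tree, with the sum of the `val` fields above it added.
As the new nodes of the path are numbered `f, f + 2, f + 4, …`, a loop going down creates them
(`downCmd_runs`), and a loop going up computes `min` and `argmin` without a stack (`upCmd_runs`).
Splicing `A` with `A + 1` at `ℓ`, and the result with the old `A` at `r`, performs the update
(`addCmd_runs`), in `O(h + 1)` steps. The sharing of nodes does no harm: old nodes are never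
changed, and the height function shows that the node being completed does not occur below itself.

**The measure as a sum of block counts.** The trie measure of a set of `L`-bit numbers is the sum,
over the block sizes `2 ^ j` with `j < L`, of the number of aligned blocks of size `2 ^ j` that meet
the set (`trie_image_bits`): `|bits x ⊕ bits y|` is the number of block sizes that separate `x`
and `y`. After a shift by `a`, each such block is counted by its first element, and an element `y`
is the first one of its block if and only if `(y + a) % 2 ^ j` is less than the cyclic distance from
`y` to its predecessor in the set, its *gap* (`first_in_block_iff`). So the count for block
size `2 ^ j` depends on `a` modulo `2 ^ j` only, and there the shifts counted for `y` form a cyclic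
interval, that is, two ranges. Starting from the array `⟨0⟩`, the program makes `2 N` range updates
for each level `j` and then doubles the array (`levelsCmd_runs`); this takes `O(N L ^ 2)` steps.

**The gaps.** Sorting is avoided. The program enters every element into a table that stores the
maximum below each node of the binary tree over the universe, one tree for each set; only the
nodes above elements are touched, so that the time is `O(N L)` (`insertCmd_runs`). The predecessor
of `y` is the maximum below the first left sibling that is nonempty on the way up from `y`, and if
there is none, the gap wraps around to the maximum of the set (`gapCmd_runs`).
-/

namespace ShiftTrie

/-! ### Reasoning about executions -/

/-- The command `c` started in `σ` halts within `T` time units in a state that satisfies `Q`. -/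
def Runs (w : ℕ) (c : Cmd) (σ : State) (T : ℕ) (Q : State → Prop) : Prop :=
  ∃ t τ, Exec w c σ t τ ∧ t ≤ T ∧ Q τ

theorem Runs.mono {w : ℕ} {c : Cmd} {σ : State} {T T' : ℕ} {Q Q' : State → Prop}
    (h : Runs w c σ T Q) (hT : T ≤ T') (hQ : ∀ τ, Q τ → Q' τ) : Runs w c σ T' Q' := by
  obtain ⟨t, τ, he, ht, hq⟩ := h
  exact ⟨t, τ, he, ht.trans hT, hQ τ hq⟩

theorem Runs.seq {w : ℕ} {c d : Cmd} {σ : State} {T T' : ℕ} {Q : State → Prop}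
    (h : Runs w c σ T fun τ => Runs w d τ T' Q) : Runs w (.seq c d) σ (T + T') Q := by
  obtain ⟨t, τ, he, ht, t', τ', he', ht', hq⟩ := h
  exact ⟨t + t', τ', .seq he he', by omega, hq⟩

theorem Runs.ite {w : ℕ} {b : Expr} {c d : Cmd} {σ : State} {T : ℕ} {Q : State → Prop}
    (h₁ : b.eval w σ ≠ 0 → Runs w c σ T Q) (h₂ : b.eval w σ = 0 → Runs w d σ T Q) :
    Runs w (.ite b c d) σ (b.cost + 1 + T) Q := by
  by_cases hb : b.eval w σ = 0
  · obtain ⟨t, τ, he, ht, hq⟩ := h₂ hb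
    exact ⟨_, τ, .iteFalse hb he, by omega, hq⟩
  · obtain ⟨t, τ, he, ht, hq⟩ := h₁ hb
    exact ⟨_, τ, .iteTrue hb he, by omega, hq⟩

theorem Runs.while_done {w : ℕ} {b : Expr} {c : Cmd} {σ : State} {Q : State → Prop}
    (hb : b.eval w σ = 0) (hQ : Q σ) : Runs w (.while b c) σ (b.cost + 1) Q :=
  ⟨_, σ, .whileFalse hb, le_rfl, hQ⟩

theorem Runs.while_step {w : ℕ} {b : Expr} {c : Cmd} {σ : State} {T T' : ℕ} {Q : State → Prop}
    (hb : b.eval w σ ≠ 0) (h : Runs w c σ T fun τ => Runs w (.while b c) τ T' Q) :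
    Runs w (.while b c) σ (b.cost + 1 + T + T') Q := by
  obtain ⟨t, τ, he, ht, t', τ', he', ht', hq⟩ := h
  exact ⟨_, τ', .whileTrue hb he he', by omega, hq⟩

/-- A loop followed by `d`, unrolled once. -/
theorem Runs.while_seq_step {w : ℕ} {b : Expr} {c d : Cmd} {σ : State} {T T' : ℕ}
    {Q : State → Prop} (hb : b.eval w σ ≠ 0)
    (h : Runs w c σ T fun τ => Runs w (.seq (.while b c) d) τ T' Q) :
    Runs w (.seq (.while b c) d) σ (b.cost + 1 + T + T') Q := by
  obtain ⟨t, τ, he, ht, t', τ', he', ht', hq⟩ := h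
  cases he' with
  | seq h₁ h₂ => exact ⟨_, τ', .seq (.whileTrue hb he h₁) h₂, by omega, hq⟩

/-- A loop with an invariant `I k`, where `k` bounds the number of the remaining iterations. -/
theorem Runs.while_of_invariant {w : ℕ} {b : Expr} {c : Cmd} {T : ℕ} {Q : State → Prop}
    (I : ℕ → State → Prop)
    (h : ∀ k σ, I k σ → (b.eval w σ = 0 ∧ Q σ) ∨
      (b.eval w σ ≠ 0 ∧ ∃ k', k = k' + 1 ∧ Runs w c σ T (I k'))) :
    ∀ k σ, I k σ → Runs w (.while b c) σ (k * (b.cost + 1 + T) + (b.cost + 1)) Q := by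
  intro k
  induction k with
  | zero =>
    intro σ hσ
    rcases h 0 σ hσ with ⟨hb, hq⟩ | ⟨-, k', hk, -⟩
    · exact (Runs.while_done hb hq).mono (by omega) fun _ => id
    · omega
  | succ k ih =>
    intro σ hσ
    rcases h _ σ hσ with ⟨hb, hq⟩ | ⟨hb, k', hk, hr⟩
    · exact (Runs.while_done hb hq).mono (by omega) fun _ => id
    · obtain rfl : k = k' := by omega
      refine (Runs.while_step hb (hr.mono le_rfl ih)).mono ?_ fun _ => id
      rw [Nat.succ_mul]; omega

/-- A counting loop: `I k` holds after `k` of the `m` iterations. -/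
theorem Runs.while_count {w : ℕ} {b : Expr} {c : Cmd} {T : ℕ} (I : ℕ → State → Prop) (m : ℕ)
    (hstep : ∀ k < m, ∀ σ, I k σ → b.eval w σ ≠ 0 ∧ Runs w c σ T (I (k + 1)))
    (hdone : ∀ σ, I m σ → b.eval w σ = 0) {σ : State} (hσ : I 0 σ) :
    Runs w (.while b c) σ (m * (b.cost + 1 + T) + (b.cost + 1)) (I m) := by
  refine Runs.while_of_invariant (fun k σ => k ≤ m ∧ I (m - k) σ) ?_ m σ ⟨le_rfl, by simpa⟩
  rintro k σ ⟨hk, hI⟩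
  rcases k with _ | k
  · exact .inl ⟨hdone σ hI, hI⟩
  · obtain ⟨h₁, h₂⟩ := hstep (m - (k + 1)) (by omega) σ hI
    refine .inr ⟨h₁, k, rfl, h₂.mono le_rfl fun τ hτ => ⟨by omega, ?_⟩⟩
    rwa [show m - (k + 1) + 1 = m - k by omega] at hτ

/-! ### Straight-line code -/

/-- The effect of a command without loops. -/
def Cmd.step (w : ℕ) : Cmd → State → State
  | .skip, σ => σ
  | .assign r e, σ => σ.setReg r (e.eval w σ)
  | .store A i e, σ => σ.setMem A (i.eval w σ) (e.eval w σ)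
  | .seq c d, σ => d.step w (c.step w σ)
  | .ite b c d, σ => if b.eval w σ = 0 then d.step w σ else c.step w σ
  | .while _ _, σ => σ

def Cmd.loopFree : Cmd → Bool
  | .seq c d => c.loopFree && d.loopFree
  | .ite _ c d => c.loopFree && d.loopFree
  | .while _ _ => false
  | _ => true

/-- A bound for the time of a command without loops. -/
def Cmd.bound : Cmd → ℕ
  | .skip => 1
  | .assign _ e => e.cost + 1
  | .store _ i e => i.cost + e.cost + 1
  | .seq c d => c.bound + d.bound
  | .ite b c d => b.cost + 1 + max c.bound d.bound
  | .while _ _ => 0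

theorem Cmd.exec_step (w : ℕ) (c : Cmd) (hc : c.loopFree = true) (σ : State) :
    ∃ t, Exec w c σ t (c.step w σ) ∧ t ≤ c.bound := by
  induction c generalizing σ with
  | skip => exact ⟨_, .skip σ, le_rfl⟩
  | assign r e => exact ⟨_, .assign r e σ, le_rfl⟩
  | store A i e => exact ⟨_, .store A i e σ, le_rfl⟩
  | seq c d ihc ihd =>
    simp only [Cmd.loopFree, Bool.and_eq_true] at hc
    obtain ⟨s, hs, hs'⟩ := ihc hc.1 σ
    obtain ⟨t, ht, ht'⟩ := ihd hc.2 (c.step w σ)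
    exact ⟨_, .seq hs ht, by simp only [Cmd.bound]; omega⟩
  | ite b c d ihc ihd =>
    simp only [Cmd.loopFree, Bool.and_eq_true] at hc
    simp only [Cmd.step, Cmd.bound]
    split_ifs with hb
    · obtain ⟨t, ht, ht'⟩ := ihd hc.2 σ
      exact ⟨_, .iteFalse hb ht, by omega⟩
    · obtain ⟨t, ht, ht'⟩ := ihc hc.1 σ
      exact ⟨_, .iteTrue hb ht, by omega⟩
  | _ => simp [Cmd.loopFree] at hc

theorem Runs.of_step {w : ℕ} {c : Cmd} {σ : State} {T : ℕ} {Q : State → Prop}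
    (hc : c.loopFree = true) (hT : c.bound ≤ T) (hQ : Q (c.step w σ)) : Runs w c σ T Q := by
  obtain ⟨t, ht, hle⟩ := c.exec_step w hc σ
  exact ⟨t, _, ht, hle.trans hT, hQ⟩

@[simp] theorem State.setReg_reg (σ : State) (r v s : ℕ) :
    (σ.setReg r v).reg s = if s = r then v else σ.reg s := by
  simp [State.setReg, Function.update_apply]

@[simp] theorem State.setReg_mem (σ : State) (r v : ℕ) : (σ.setReg r v).mem = σ.mem := rfl

@[simp] theorem State.setMem_reg (σ : State) (A i v : ℕ) : (σ.setMem A i v).reg = σ.reg := rfl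

@[simp] theorem State.setMem_mem (σ : State) (A i v B j : ℕ) :
    (σ.setMem A i v).mem B j = if B = A ∧ j = i then v else σ.mem B j := by
  by_cases hB : B = A
  · subst hB
    simp [State.setMem, Function.update_apply]
  · simp [State.setMem, hB]

/-! ### Registers and arrays that a command leaves alone -/

/-- The registers that a command may change. -/
def Cmd.regs : Cmd → List ℕ
  | .assign r _ => [r]
  | .seq c d => c.regs ++ d.regs
  | .ite _ c d => c.regs ++ d.regs
  | .while _ c => c.regs
  | _ => []

/-- The arrays that a command may change. -/
def Cmd.arrs : Cmd → List ℕ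
  | .store A _ _ => [A]
  | .seq c d => c.arrs ++ d.arrs
  | .ite _ c d => c.arrs ++ d.arrs
  | .while _ c => c.arrs
  | _ => []

theorem Exec.frame {w : ℕ} {c : Cmd} {σ τ : State} {t : ℕ} (h : Exec w c σ t τ) :
    (∀ r ∉ c.regs, τ.reg r = σ.reg r) ∧ ∀ A ∉ c.arrs, τ.mem A = σ.mem A := by
  induction h with
  | skip => simp
  | assign r e σ =>
    refine ⟨fun s hs => ?_, fun _ _ => rfl⟩
    simp only [Cmd.regs, List.mem_singleton] at hs
    simp [hs]
  | store A i e σ =>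
    refine ⟨fun _ _ => rfl, fun B hB => ?_⟩
    simp only [Cmd.arrs, List.mem_singleton] at hB
    ext j
    simp [hB]
  | seq hc hd ihc ihd =>
    simp only [Cmd.regs, Cmd.arrs, List.mem_append, not_or]
    exact ⟨fun r hr => (ihd.1 r hr.2).trans (ihc.1 r hr.1),
      fun A hA => (ihd.2 A hA.2).trans (ihc.2 A hA.1)⟩
  | iteTrue hb hc ih =>
    simp only [Cmd.regs, Cmd.arrs, List.mem_append, not_or]
    exact ⟨fun r hr => ih.1 r hr.1, fun A hA => ih.2 A hA.1⟩
  | iteFalse hb hc ih =>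
    simp only [Cmd.regs, Cmd.arrs, List.mem_append, not_or]
    exact ⟨fun r hr => ih.1 r hr.2, fun A hA => ih.2 A hA.2⟩
  | whileTrue hb hc hl ihc ihl =>
    exact ⟨fun r hr => (ihl.1 r hr).trans (ihc.1 r hr),
      fun A hA => (ihl.2 A hA).trans (ihc.2 A hA)⟩
  | whileFalse hb => simp

theorem Runs.frame {w : ℕ} {c : Cmd} {σ : State} {T : ℕ} {Q : State → Prop}
    (h : Runs w c σ T Q) :
    Runs w c σ T fun τ => Q τ ∧ (∀ r ∉ c.regs, τ.reg r = σ.reg r) ∧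
      ∀ A ∉ c.arrs, τ.mem A = σ.mem A := by
  obtain ⟨t, τ, he, ht, hq⟩ := h
  exact ⟨t, τ, he, ht, hq, he.frame⟩

/-! ### Notation for programs

Register 0 holds the result, and registers 1 to 5 and arrays 2 to 6 are those of the data structure.
Registers 6 to 18 are the working space of the range update:
`r6`, `r7` are the nodes that have been reached in two trees, `r8`, `r9` the sums of the `val`
fields above them, `r10` the position, relative to these nodes, where the trees are spliced,
`r11` a power of two (half the length of the current subtree), `r12`, `r13` the node to be copied
and the summand for its fields, `r14` the new root, `r15` the current node on the way up, `r16` the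
root before the update, `r17` the length of the array, and `r18` a counter.

The program for the optimal shift uses registers 20 to 34 besides: `r20 = u`, `r21 = n`, `r26 = N`,
`r27` is the index of the current element, `r28` the element, `r29` the offset of the table of its
set, `r25` a node of this table, `r31` a gap, `r32` the current block size `2 ^ j`. Array 7 is the
table, and cell `k` of arrays 8 and 9 holds the table offset and the gap of the element number `k`.
-/

infixr:50 " ;; " => Cmd.seq
infix:60 " ::= " => Cmd.assign
infixl:65 " ⊞ " => Expr.bin Op.add
infixl:65 " ⊟ " => Expr.bin Op.sub
infixl:70 " ⊠ " => Expr.bin Op.mul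
infixl:70 " ⊘ " => Expr.bin Op.div
infixl:70 " ⊛ " => Expr.bin Op.mod
infix:55 " ⊏ " => Expr.bin Op.lt

/-! ### Nodes -/

/-- `IsDag`, with the memory and the bound for the nodes as separate arguments. -/
def Dag (m : ℕ → ℕ → ℕ) (ht : ℕ → ℕ) (f : ℕ) : ℕ → ℕ → (ℕ → ℕ) → Prop
  | 0, p, A =>
      p < f ∧ ht p = 0 ∧ m valArr p = A 0 ∧ m minArr p = A 0 ∧ m argminArr p = 0
  | h + 1, p, A =>
      p < f ∧ ht p = h + 1 ∧
      m argminArr p < 2 ^ (h + 1) ∧ A (m argminArr p) = m minArr p ∧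
      (∀ a < 2 ^ (h + 1), m minArr p ≤ A a) ∧
      (∀ a < 2 ^ (h + 1), m valArr p ≤ A a) ∧
      Dag m ht f h (m leftArr p) (fun a => A a - m valArr p) ∧
      Dag m ht f h (m rightArr p) (fun a => A (2 ^ h + a) - m valArr p)

theorem isDag_iff_dag {σ : State} {ht : ℕ → ℕ} {h p : ℕ} {A : ℕ → ℕ} :
    IsDag σ ht h p A ↔ Dag σ.mem ht (σ.reg freeReg) h p A := by
  induction h generalizing p A with
  | zero => rfl
  | succ h ih => simp only [IsDag, Dag, ih]

theorem Dag.node {m : ℕ → ℕ → ℕ} {ht : ℕ → ℕ} {f h p : ℕ} {A : ℕ → ℕ} (d : Dag m ht f h p A) :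
    p < f ∧ ht p = h ∧ m argminArr p < 2 ^ h ∧ A (m argminArr p) = m minArr p ∧
      (∀ a < 2 ^ h, m minArr p ≤ A a) ∧ ∀ a < 2 ^ h, m valArr p ≤ A a := by
  cases h with
  | zero =>
    obtain ⟨h₁, h₂, h₃, h₄, h₅⟩ := d
    refine ⟨h₁, h₂, by simp [h₅], by rw [h₅, h₄], fun a ha => ?_, fun a ha => ?_⟩
    · obtain rfl : a = 0 := by omega
      exact h₄.le
    · obtain rfl : a = 0 := by omega
      exact h₃.le
  | succ h =>
    obtain ⟨h₁, h₂, h₃, h₄, h₅, h₆, -⟩ := d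
    exact ⟨h₁, h₂, h₃, h₄, h₅, h₆⟩

/-- A DAG of height `h` below `f` depends only on the heights of the nodes below `f` and on the
fields of those of height at most `h`. -/
theorem Dag.transfer {m m' : ℕ → ℕ → ℕ} {ht ht' : ℕ → ℕ} {f f' h p : ℕ} {A B : ℕ → ℕ}
    (d : Dag m ht f h p A) (hf : f ≤ f')
    (hm : ∀ X, 2 ≤ X → X ≤ 6 → ∀ i < f, ht i ≤ h → m' X i = m X i) (hht : ∀ i < f, ht' i = ht i)
    (hA : ∀ a < 2 ^ h, B a = A a) : Dag m' ht' f' h p B := by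
  induction h generalizing p A B with
  | zero =>
    obtain ⟨h₁, h₂, h₃, h₄, h₅⟩ := d
    refine ⟨by omega, by rw [hht p h₁, h₂], ?_, ?_, ?_⟩
    · rw [hm _ (by decide) (by decide) p h₁ h₂.le, h₃, hA 0 (by simp)]
    · rw [hm _ (by decide) (by decide) p h₁ h₂.le, h₄, hA 0 (by simp)]
    · rw [hm _ (by decide) (by decide) p h₁ h₂.le, h₅]
  | succ h ih =>
    obtain ⟨h₁, h₂, h₃, h₄, h₅, h₆, h₇, h₈⟩ := d
    have hX : ∀ X, 2 ≤ X → X ≤ 6 → m' X p = m X p := fun X a b => hm X a b p h₁ h₂.le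
    simp only [Dag]
    rw [hX _ (by decide) (by decide), hX minArr (by decide) (by decide),
      hX leftArr (by decide) (by decide), hX rightArr (by decide) (by decide),
      hX valArr (by decide) (by decide), hht p h₁]
    refine ⟨by omega, h₂, h₃, by rw [hA _ h₃, h₄], fun a ha => by rw [hA a ha]; exact h₅ a ha,
      fun a ha => by rw [hA a ha]; exact h₆ a ha,
      ih h₇ (fun X a b i hi hh => hm X a b i hi (by omega)) fun a ha => ?_,
      ih h₈ (fun X a b i hi hh => hm X a b i hi (by omega)) fun a ha => ?_⟩
    · show B a - _ = A a - _
      rw [hA a (by rw [pow_succ]; omega)]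
    · show B _ - _ = A _ - _
      rw [hA _ (by rw [pow_succ]; omega)]

/-- A copy `q` of the node `p` with `val` and `min` increased by `x` represents `A + x`. -/
theorem Dag.copy {m : ℕ → ℕ → ℕ} {ht : ℕ → ℕ} {f h p q x : ℕ} {A : ℕ → ℕ}
    (d : Dag m ht f h p A) (hq : q < f) (hht : ht q = h) (hval : m valArr q = m valArr p + x)
    (hmin : m minArr q = m minArr p + x) (harg : m argminArr q = m argminArr p)
    (hl : m leftArr q = m leftArr p) (hr : m rightArr q = m rightArr p) :
    Dag m ht f h q (fun a => A a + x) := by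
  cases h with
  | zero =>
    obtain ⟨h₁, h₂, h₃, h₄, h₅⟩ := d
    exact ⟨hq, hht, by rw [hval, h₃], by rw [hmin, h₄], by rw [harg, h₅]⟩
  | succ h =>
    obtain ⟨h₁, h₂, h₃, h₄, h₅, h₆, h₇, h₈⟩ := d
    simp only [Dag]
    rw [hval, hmin, harg, hl, hr]
    refine ⟨hq, hht, h₃, by rw [h₄], fun a ha => ?_, fun a ha => ?_, ?_, ?_⟩
    · have := h₅ a ha; omega
    · have := h₆ a ha; omega
    · simpa only [Nat.add_sub_add_right] using h₇
    · simpa only [Nat.add_sub_add_right] using h₈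

/-! ### Splicing two trees -/

/-- Makes the node `freeReg` a copy of node `r12`, with `val` and `min` increased by `r13`. -/
def copyNode : Cmd :=
  .store valArr (.reg 4) (.load valArr (.reg 12) ⊞ .reg 13) ;;
  .store minArr (.reg 4) (.load minArr (.reg 12) ⊞ .reg 13) ;;
  .store argminArr (.reg 4) (.load argminArr (.reg 12)) ;;
  .store leftArr (.reg 4) (.load leftArr (.reg 12)) ;;
  .store rightArr (.reg 4) (.load rightArr (.reg 12))

/-- One step down: allocates the path node `freeReg`, and the sibling after it. The sibling is taken
from the second tree if the path goes left, as then it lies to the right of the position of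
splicing, and from the first tree otherwise. -/
def downBody : Cmd :=
  11 ::= .reg 11 ⊘ .const 2 ;;
  8 ::= .reg 8 ⊞ .load valArr (.reg 6) ;;
  9 ::= .reg 9 ⊞ .load valArr (.reg 7) ;;
  .store valArr (.reg 4) (.const 0) ;;
  .ite (.reg 10 ⊏ .reg 11)
    (12 ::= .load rightArr (.reg 7) ;; 13 ::= .reg 9 ;;
      .store leftArr (.reg 4) (.reg 4 ⊞ .const 2) ;;
      .store rightArr (.reg 4) (.reg 4 ⊞ .const 1) ;;
      6 ::= .load leftArr (.reg 6) ;; 7 ::= .load leftArr (.reg 7))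
    (12 ::= .load leftArr (.reg 6) ;; 13 ::= .reg 8 ;;
      .store leftArr (.reg 4) (.reg 4 ⊞ .const 1) ;;
      .store rightArr (.reg 4) (.reg 4 ⊞ .const 2) ;;
      10 ::= .reg 10 ⊟ .reg 11 ;;
      6 ::= .load rightArr (.reg 6) ;; 7 ::= .load rightArr (.reg 7)) ;;
  4 ::= .reg 4 ⊞ .const 1 ;;
  copyNode ;;
  4 ::= .reg 4 ⊞ .const 1

/-- Allocates the leaf at the end of the path; its value comes from the second tree. -/
def leafCmd : Cmd :=
  9 ::= .reg 9 ⊞ .load valArr (.reg 7) ;;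
  .store valArr (.reg 4) (.reg 9) ;;
  .store minArr (.reg 4) (.reg 9) ;;
  .store argminArr (.reg 4) (.const 0) ;;
  15 ::= .reg 4 ;;
  4 ::= .reg 4 ⊞ .const 1

theorem downBody_left {w s p q ap aq pos f : ℕ} {σ : State}
    (hs : σ.reg 11 = 2 * s) (hp : σ.reg 6 = p) (hq : σ.reg 7 = q) (hap : σ.reg 8 = ap)
    (haq : σ.reg 9 = aq) (hpos : σ.reg 10 = pos) (hf : σ.reg 4 = f)
    (hpf : p < f) (hqf : q < f) (hsf : σ.mem rightArr q < f)
    (hw : f + 2 < 2 ^ w) (hsw : s < 2 ^ w) (hlt : pos < s)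
    (hwp : ap + σ.mem valArr p < 2 ^ w) (hwq : aq + σ.mem valArr q < 2 ^ w)
    (hwv : σ.mem valArr (σ.mem rightArr q) + (aq + σ.mem valArr q) < 2 ^ w)
    (hwm : σ.mem minArr (σ.mem rightArr q) + (aq + σ.mem valArr q) < 2 ^ w) :
    ∃ τ, downBody.step w σ = τ ∧ τ.reg 11 = s ∧ τ.reg 10 = pos ∧
      τ.reg 6 = σ.mem leftArr p ∧ τ.reg 7 = σ.mem leftArr q ∧
      τ.reg 8 = ap + σ.mem valArr p ∧ τ.reg 9 = aq + σ.mem valArr q ∧ τ.reg 4 = f + 2 ∧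
      (∀ X, ∀ i < f, τ.mem X i = σ.mem X i) ∧ τ.mem valArr f = 0 ∧
      τ.mem leftArr f = f + 2 ∧ τ.mem rightArr f = f + 1 ∧
      τ.mem valArr (f + 1) = σ.mem valArr (σ.mem rightArr q) + (aq + σ.mem valArr q) ∧
      τ.mem minArr (f + 1) = σ.mem minArr (σ.mem rightArr q) + (aq + σ.mem valArr q) ∧
      τ.mem argminArr (f + 1) = σ.mem argminArr (σ.mem rightArr q) ∧
      τ.mem leftArr (f + 1) = σ.mem leftArr (σ.mem rightArr q) ∧
      τ.mem rightArr (f + 1) = σ.mem rightArr (σ.mem rightArr q) := by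
  have e1 : 1 % 2 ^ w = 1 := Nat.mod_eq_of_lt (by omega)
  have e2 : 2 % 2 ^ w = 2 := Nat.mod_eq_of_lt (by omega)
  have e3 : (f + 1) % 2 ^ w = f + 1 := Nat.mod_eq_of_lt (by omega)
  have e4 : (f + 1 + 1) % 2 ^ w = f + 2 := Nat.mod_eq_of_lt (by omega)
  have n1 : p ≠ f := by omega
  have n2 : q ≠ f := by omega
  have n3 : σ.mem rightArr q ≠ f := by omega
  have n4 : σ.mem rightArr q ≠ f + 1 := by omega
  refine ⟨_, rfl, ?_⟩
  simp [downBody, copyNode, Cmd.step, Expr.eval, Op.apply, hs, hp, hq, hap, haq, hpos, hf, e1, e2,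
    e3, e4, Nat.mod_eq_of_lt hsw, Nat.mod_eq_of_lt hwp, Nat.mod_eq_of_lt hwq, hlt, n1, n2, n3,
    n4, Nat.mod_eq_of_lt hwv, Nat.mod_eq_of_lt hwm]
  intro X i hi
  simp [show i ≠ f by omega, show i ≠ f + 1 by omega]

theorem downBody_right {w s p q ap aq pos f : ℕ} {σ : State}
    (hs : σ.reg 11 = 2 * s) (hp : σ.reg 6 = p) (hq : σ.reg 7 = q) (hap : σ.reg 8 = ap)
    (haq : σ.reg 9 = aq) (hpos : σ.reg 10 = s + pos) (hf : σ.reg 4 = f)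
    (hpf : p < f) (hqf : q < f) (hsf : σ.mem leftArr p < f)
    (hw : f + 2 < 2 ^ w) (hsw : s < 2 ^ w) (hpw : pos < 2 ^ w)
    (hwp : ap + σ.mem valArr p < 2 ^ w) (hwq : aq + σ.mem valArr q < 2 ^ w)
    (hwv : σ.mem valArr (σ.mem leftArr p) + (ap + σ.mem valArr p) < 2 ^ w)
    (hwm : σ.mem minArr (σ.mem leftArr p) + (ap + σ.mem valArr p) < 2 ^ w) :
    ∃ τ, downBody.step w σ = τ ∧ τ.reg 11 = s ∧ τ.reg 10 = pos ∧
      τ.reg 6 = σ.mem rightArr p ∧ τ.reg 7 = σ.mem rightArr q ∧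
      τ.reg 8 = ap + σ.mem valArr p ∧ τ.reg 9 = aq + σ.mem valArr q ∧ τ.reg 4 = f + 2 ∧
      (∀ X, ∀ i < f, τ.mem X i = σ.mem X i) ∧ τ.mem valArr f = 0 ∧
      τ.mem leftArr f = f + 1 ∧ τ.mem rightArr f = f + 2 ∧
      τ.mem valArr (f + 1) = σ.mem valArr (σ.mem leftArr p) + (ap + σ.mem valArr p) ∧
      τ.mem minArr (f + 1) = σ.mem minArr (σ.mem leftArr p) + (ap + σ.mem valArr p) ∧
      τ.mem argminArr (f + 1) = σ.mem argminArr (σ.mem leftArr p) ∧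
      τ.mem leftArr (f + 1) = σ.mem leftArr (σ.mem leftArr p) ∧
      τ.mem rightArr (f + 1) = σ.mem rightArr (σ.mem leftArr p) := by
  have e1 : 1 % 2 ^ w = 1 := Nat.mod_eq_of_lt (by omega)
  have e2 : 2 % 2 ^ w = 2 := Nat.mod_eq_of_lt (by omega)
  have e3 : (f + 1) % 2 ^ w = f + 1 := Nat.mod_eq_of_lt (by omega)
  have e4 : (f + 1 + 1) % 2 ^ w = f + 2 := Nat.mod_eq_of_lt (by omega)
  have n1 : p ≠ f := by omega
  have n2 : q ≠ f := by omega
  have n3 : σ.mem leftArr p ≠ f := by omega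
  have n4 : σ.mem leftArr p ≠ f + 1 := by omega
  refine ⟨_, rfl, ?_⟩
  simp [downBody, copyNode, Cmd.step, Expr.eval, Op.apply, hs, hp, hq, hap, haq, hpos, hf, e1, e2,
    e3, e4, Nat.mod_eq_of_lt hsw, Nat.mod_eq_of_lt hwp, Nat.mod_eq_of_lt hwq, n1, n2, n3,
    n4, Nat.mod_eq_of_lt hwv, Nat.mod_eq_of_lt hwm, Nat.mod_eq_of_lt hpw]
  intro X i hi
  simp [show i ≠ f by omega, show i ≠ f + 1 by omega]

/-- The path of new nodes `x, x + 2, …, x + 2 * k`, where the sibling of `x + 2 * i` is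
`x + 2 * i - 1`. The path represents `B`, but the fields `min` and `argmin` of its inner nodes may
not be set yet. -/
def PathDag (m : ℕ → ℕ → ℕ) (ht : ℕ → ℕ) : ℕ → ℕ → (ℕ → ℕ) → Prop
  | 0, x, B => Dag m ht (x + 1) 0 x B
  | k + 1, x, B => ht x = k + 1 ∧ m valArr x = 0 ∧
      ((m leftArr x = x + 2 ∧ m rightArr x = x + 1 ∧ PathDag m ht k (x + 2) B ∧
          Dag m ht (x + 2) k (x + 1) (fun a => B (2 ^ k + a))) ∨
        (m leftArr x = x + 1 ∧ m rightArr x = x + 2 ∧ Dag m ht (x + 2) k (x + 1) B ∧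
          PathDag m ht k (x + 2) (fun a => B (2 ^ k + a))))

def downCmd : Cmd := .while (.const 1 ⊏ .reg 11) downBody ;; leafCmd

/-- The way down leaves a path that represents the spliced sequence `B`. The sums `Ap + ap` and
`Aq + aq` are the invariants of the descent, as the `val` field that is subtracted from the sequence
of a child is added to `ap` or `aq`. -/
theorem downCmd_runs {w : ℕ} {ht : ℕ → ℕ} (k : ℕ) :
    ∀ {σ : State} {p q ap aq pos f : ℕ} {Ap Aq B : ℕ → ℕ},
    σ.reg 11 = 2 ^ k → σ.reg 6 = p → σ.reg 7 = q → σ.reg 8 = ap → σ.reg 9 = aq →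
    σ.reg 10 = pos → σ.reg 4 = f → Dag σ.mem ht f k p Ap → Dag σ.mem ht f k q Aq →
    pos < 2 ^ k → f + 2 * k + 1 < 2 ^ w → 2 ^ k < 2 ^ w →
    (∀ a < 2 ^ k, B a = if a < pos then Ap a + ap else Aq a + aq) →
    (∀ a < 2 ^ k, Ap a + ap < 2 ^ w) → (∀ a < 2 ^ k, Aq a + aq < 2 ^ w) →
    (∀ i ≤ k, ht (f + 2 * i) = k - i) → (∀ i < k, ht (f + 2 * i + 1) = k - i - 1) →
    Runs w downCmd σ (k * 100 + 40) fun τ => PathDag τ.mem ht k f B ∧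
      τ.reg 4 = f + 2 * k + 1 ∧ τ.reg 15 = f + 2 * k ∧ τ.reg 11 = 1 ∧
      ∀ X, ∀ i < f, τ.mem X i = σ.mem X i := by
  induction k with
  | zero =>
    intro σ p q ap aq pos f Ap Aq B hs hp hq hap haq hpos hf dp dq hlt hw hkw hB hwp hwq hh hh'
    have e1 : 1 % 2 ^ w = 1 := Nat.mod_eq_of_lt (by omega)
    have e2 : (f + 1) % 2 ^ w = f + 1 := Nat.mod_eq_of_lt (by omega)
    obtain ⟨h₁, h₂, h₃, h₄, h₅⟩ := dq
    have hB0 := hB 0 (by simp)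
    have hw0 := hwq 0 (by simp)
    rw [if_neg (by omega)] at hB0
    have e3 : (aq + σ.mem 2 q) % 2 ^ w = B 0 := by
      rw [hB0, ← h₃, Nat.add_comm, Nat.mod_eq_of_lt (by rw [Nat.add_comm, h₃]; omega)]
    refine (Runs.seq (T := 4) (T' := 36) (Runs.while_done ?_
      (Runs.of_step rfl (by decide) ?_))).mono (by omega) fun _ => id
    · simp [Expr.eval, Op.apply, hs, e1]
    · have := hh 0 le_rfl
      simp at this
      simp [leafCmd, Cmd.step, Expr.eval, Op.apply, hq, haq, hf, PathDag, Dag, hs, e2, e3, this]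
      intro X i hi
      simp [show i ≠ f by omega]
  | succ k ih =>
    intro σ p q ap aq pos f Ap Aq B hs hp hq hap haq hpos hf dp dq hlt hw hkw hB hwp hwq hh hh'
    have hk2 : 2 ^ (k + 1) = 2 ^ k + 2 ^ k := by rw [pow_succ]; omega
    have hk0 : 0 < 2 ^ k := by positivity
    obtain ⟨p₁, p₂, p₃, p₄, p₅, p₆, p₇, p₈⟩ := dp
    obtain ⟨q₁, q₂, q₃, q₄, q₅, q₆, q₇, q₈⟩ := dq
    have hvp : ap + σ.mem valArr p < 2 ^ w := by
      have := p₆ 0 (by omega); have := hwp 0 (by omega); omega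
    have hvq : aq + σ.mem valArr q < 2 ^ w := by
      have := q₆ 0 (by omega); have := hwq 0 (by omega); omega
    have hguard : (Expr.const 1 ⊏ Expr.reg 11).eval w σ ≠ 0 := by
      have e1 : 1 % 2 ^ w = 1 := Nat.mod_eq_of_lt (by omega)
      simp [Expr.eval, Op.apply, hs, e1]
    have hb : downBody.bound ≤ 96 := by decide
    -- the path goes left or right; in each case the rest of the path is handled by `ih`
    rcases lt_or_ge pos (2 ^ k) with hpk | hpk
    · obtain ⟨s₁, s₂, s₃, s₄, s₅, s₆⟩ := q₈.node
      obtain ⟨τ, hτ, t11, t10, t6, t7, t8, t9, t4, tm, tv, tl, tr, cv, cm, ca, cl, cr⟩ :=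
        downBody_left (by rw [hs]; omega) hp hq hap haq hpos hf p₁ q₁ s₁ (by omega) (by omega) hpk
          hvp hvq (by have := s₆ _ hk0; have := hwq (2 ^ k + 0) (by omega); omega)
          (by have := s₅ _ hk0; have := hwq (2 ^ k + 0) (by omega); omega)
      refine (Runs.while_seq_step (T := 96) (T' := k * 100 + 40) hguard
        (Runs.of_step rfl hb ?_)).mono (by simp only [Expr.cost]; omega) fun _ => id
      rw [hτ]
      have trans : ∀ {r A}, Dag σ.mem ht f k r A → Dag τ.mem ht (f + 2) k r A := fun d =>
        d.transfer (by omega) (fun X _ _ i hi _ => tm X i hi) (fun _ _ => rfl) fun _ _ => rfl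
      refine (ih (B := B) t11 t6 t7 t8 t9 t10 t4 (trans p₇) (trans q₇) hpk (by omega)
        (by omega) ?_ ?_ ?_ ?_ ?_).mono le_rfl ?_
      · intro a ha
        have := p₆ a (by omega); have := q₆ a (by omega)
        rw [hB a (by omega)]
        split_ifs <;> omega
      · intro a ha
        have := p₆ a (by omega); have := hwp a (by omega); omega
      · intro a ha
        have := q₆ a (by omega); have := hwq a (by omega); omega
      · intro i hi
        rw [show f + 2 + 2 * i = f + 2 * (i + 1) by ring, hh _ (by omega)]; omega
      · intro i hi
        rw [show f + 2 + 2 * i + 1 = f + 2 * (i + 1) + 1 by ring, hh' _ (by omega)]; omega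
      · rintro ρ ⟨r₁, r₂, r₃, r₄, r₅⟩
        refine ⟨⟨by simpa using hh 0 (by omega), by rw [r₅ _ _ (by omega), tv],
          .inl ⟨by rw [r₅ _ _ (by omega), tl], by rw [r₅ _ _ (by omega), tr], r₁, ?_⟩⟩, by omega,
          by omega, r₄, fun X i hi => by rw [r₅ _ _ (by omega), tm _ _ hi]⟩
        have d := (trans q₈).copy (q := f + 1) (x := aq + σ.mem valArr q) (by omega)
          (by simpa using hh' 0 (by omega)) (by rw [cv, tm _ _ s₁]) (by rw [cm, tm _ _ s₁])
          (by rw [ca, tm _ _ s₁]) (by rw [cl, tm _ _ s₁]) (by rw [cr, tm _ _ s₁])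
        refine d.transfer le_rfl (fun X _ _ i hi _ => r₅ X i hi) (fun _ _ => rfl) fun a ha => ?_
        have := q₆ (2 ^ k + a) (by omega)
        show B _ = Aq _ - _ + _
        rw [hB _ (by omega), if_neg (by omega)]
        omega
    · obtain ⟨pos, rfl⟩ := Nat.exists_eq_add_of_le hpk
      obtain ⟨s₁, s₂, s₃, s₄, s₅, s₆⟩ := p₇.node
      obtain ⟨τ, hτ, t11, t10, t6, t7, t8, t9, t4, tm, tv, tl, tr, cv, cm, ca, cl, cr⟩ :=
        downBody_right (by rw [hs]; omega) hp hq hap haq hpos hf p₁ q₁ s₁ (by omega) (by omega)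
          (by omega)
          hvp hvq (by have := s₆ _ hk0; have := hwp 0 (by omega); omega)
          (by have := s₅ _ hk0; have := hwp 0 (by omega); omega)
      refine (Runs.while_seq_step (T := 96) (T' := k * 100 + 40) hguard
        (Runs.of_step rfl hb ?_)).mono (by simp only [Expr.cost]; omega) fun _ => id
      rw [hτ]
      have trans : ∀ {r A}, Dag σ.mem ht f k r A → Dag τ.mem ht (f + 2) k r A := fun d =>
        d.transfer (by omega) (fun X _ _ i hi _ => tm X i hi) (fun _ _ => rfl) fun _ _ => rfl
      refine (ih (B := fun a => B (2 ^ k + a)) t11 t6 t7 t8 t9 t10 t4 (trans p₈) (trans q₈)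
        (by omega) (by omega) (by omega) ?_ ?_ ?_ ?_ ?_).mono le_rfl ?_
      · intro a ha
        have := p₆ (2 ^ k + a) (by omega); have := q₆ (2 ^ k + a) (by omega)
        show B _ = _
        rw [hB _ (by omega)]
        split_ifs <;> omega
      · intro a ha
        have := p₆ (2 ^ k + a) (by omega); have := hwp (2 ^ k + a) (by omega); omega
      · intro a ha
        have := q₆ (2 ^ k + a) (by omega); have := hwq (2 ^ k + a) (by omega); omega
      · intro i hi
        rw [show f + 2 + 2 * i = f + 2 * (i + 1) by ring, hh _ (by omega)]; omega
      · intro i hi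
        rw [show f + 2 + 2 * i + 1 = f + 2 * (i + 1) + 1 by ring, hh' _ (by omega)]; omega
      · rintro ρ ⟨r₁, r₂, r₃, r₄, r₅⟩
        refine ⟨⟨by simpa using hh 0 (by omega), by rw [r₅ _ _ (by omega), tv],
          .inr ⟨by rw [r₅ _ _ (by omega), tl], by rw [r₅ _ _ (by omega), tr], ?_, r₁⟩⟩, by omega,
          by omega, r₄, fun X i hi => by rw [r₅ _ _ (by omega), tm _ _ hi]⟩
        have d := (trans p₇).copy (q := f + 1) (x := ap + σ.mem valArr p) (by omega)
          (by simpa using hh' 0 (by omega)) (by rw [cv, tm _ _ s₁]) (by rw [cm, tm _ _ s₁])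
          (by rw [ca, tm _ _ s₁]) (by rw [cl, tm _ _ s₁]) (by rw [cr, tm _ _ s₁])
        refine d.transfer le_rfl (fun X _ _ i hi _ => r₅ X i hi) (fun _ _ => rfl) fun a ha => ?_
        have := p₆ a (by omega)
        show B _ = Ap _ - _ + _
        rw [hB _ (by omega), if_pos (by omega)]
        omega

/-- One step up: sets `min` and `argmin` of the path node before the current one, whose halves have
the length `r11`. Path nodes are two apart. -/
def upBody : Cmd :=
  15 ::= .reg 15 ⊟ .const 2 ;;
  .ite (.load minArr (.load rightArr (.reg 15)) ⊏ .load minArr (.load leftArr (.reg 15)))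
    (.store minArr (.reg 15) (.load minArr (.load rightArr (.reg 15))) ;;
      .store argminArr (.reg 15) (.reg 11 ⊞ .load argminArr (.load rightArr (.reg 15))))
    (.store minArr (.reg 15) (.load minArr (.load leftArr (.reg 15))) ;;
      .store argminArr (.reg 15) (.load argminArr (.load leftArr (.reg 15)))) ;;
  11 ::= .reg 11 ⊠ .const 2

def upCmd : Cmd := .while (.reg 14 ⊏ .reg 15) upBody

/-- The node `x` becomes correct once its `min` and `argmin` are computed from its children. -/
theorem Dag.join {m m' : ℕ → ℕ → ℕ} {ht : ℕ → ℕ} {f k x l r : ℕ} {B : ℕ → ℕ}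
    (dl : Dag m ht f k l B) (dr : Dag m ht f k r fun a => B (2 ^ k + a))
    (hx : x < f) (hht : ht x = k + 1) (hv : m' valArr x = 0)
    (hl : m' leftArr x = l) (hr : m' rightArr x = r)
    (hmin : m' minArr x = if m minArr r < m minArr l then m minArr r else m minArr l)
    (harg : m' argminArr x =
      if m minArr r < m minArr l then 2 ^ k + m argminArr r else m argminArr l)
    (dl' : Dag m' ht f k l B) (dr' : Dag m' ht f k r fun a => B (2 ^ k + a)) :
    Dag m' ht f (k + 1) x B := by
  have hk2 : 2 ^ (k + 1) = 2 ^ k + 2 ^ k := by rw [pow_succ]; omega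
  obtain ⟨-, -, l₃, l₄, l₅, -⟩ := dl.node
  obtain ⟨-, -, r₃, r₄, r₅, -⟩ := dr.node
  have key : ∀ a < 2 ^ (k + 1), m minArr l ≤ B a ∨ m minArr r ≤ B a := by
    intro a ha
    rcases lt_or_ge a (2 ^ k) with h | h
    · exact .inl (l₅ a h)
    · obtain ⟨a, rfl⟩ := Nat.exists_eq_add_of_le h
      exact .inr (r₅ a (by omega))
  simp only [Dag]
  rw [hv, hl, hr, hmin, harg]
  refine ⟨hx, hht, ?_, ?_, fun a ha => ?_, fun _ _ => Nat.zero_le _, dl', dr'⟩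
  · split_ifs <;> omega
  · split_ifs
    · exact r₄
    · exact l₄
  · rcases key a ha with h | h <;> split_ifs <;> omega

/-- The loop that goes up a path completes its nodes. The statement is in continuation-passing form,
so that the induction can append the iteration for `x` to those for the nodes below: if the loop,
continued from a state in which `x` is complete, reaches `Q` within `T'` steps, then it does so
within `k * 60 + T'` steps from the lower end of the path. -/
theorem upCmd_runs {w : ℕ} {ht : ℕ → ℕ} {f₀ : ℕ} (k : ℕ) :
    ∀ {σ : State} {x : ℕ} {B : ℕ → ℕ} {T' : ℕ} {Q : State → Prop},
    σ.reg 14 = f₀ → f₀ ≤ x → σ.reg 15 = x + 2 * k → σ.reg 11 = 1 → PathDag σ.mem ht k x B →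
    x + 2 * k < 2 ^ w → 2 ^ k < 2 ^ w →
    (∀ τ : State, τ.reg 14 = f₀ → τ.reg 15 = x → τ.reg 11 = 2 ^ k → τ.reg 4 = σ.reg 4 →
      Dag τ.mem ht (x + 2 * k + 1) k x B → (∀ X, ∀ i < x, τ.mem X i = σ.mem X i) →
      Runs w upCmd τ T' Q) →
    Runs w upCmd σ (k * 60 + T') Q := by
  induction k with
  | zero =>
    intro σ x B T' Q hf hx hr hs hd hw hkw h
    exact (h σ hf hr hs rfl hd fun _ _ _ => rfl).mono (by omega) fun _ => id
  | succ k ih =>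
    intro σ x B T' Q hf hx hr hs hd hw hkw h
    have hk2 : 2 ^ (k + 1) = 2 ^ k + 2 ^ k := by rw [pow_succ]; omega
    have hk0 : 0 < 2 ^ k := by positivity
    obtain ⟨d₁, d₂, d₃⟩ := hd
    have e2 : 2 % 2 ^ w = 2 := Nat.mod_eq_of_lt (by omega)
    have es : (2 ^ k * 2) % 2 ^ w = 2 ^ (k + 1) := by
      rw [← pow_succ, Nat.mod_eq_of_lt hkw]
    -- what remains once the nodes below `x` are complete
    have main : ∀ τ : State, τ.reg 14 = f₀ → τ.reg 15 = x + 2 → τ.reg 11 = 2 ^ k →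
        τ.reg 4 = σ.reg 4 → (∀ X, ∀ i < x + 2, τ.mem X i = σ.mem X i) →
        Dag τ.mem ht (x + 2 * (k + 1) + 1) k (τ.mem leftArr x) B →
        Dag τ.mem ht (x + 2 * (k + 1) + 1) k (τ.mem rightArr x) (fun a => B (2 ^ k + a)) →
        Runs w upCmd τ (60 + T') Q := by
      intro τ t14 t15 t11 t4 tm dl dr
      have nl : τ.mem leftArr x ≠ x := fun e => by
        have := dl.node.2.1; rw [e, d₁] at this; omega
      have nr : τ.mem rightArr x ≠ x := fun e => by
        have := dr.node.2.1; rw [e, d₁] at this; omega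
      have hb : upBody.bound ≤ 56 := by decide
      refine (Runs.while_step (T := 56) (T' := T') ?_ (Runs.of_step rfl hb ?_)).mono
        (by simp only [Expr.cost]; omega) fun _ => id
      · have : 1 % 2 ^ w = 1 := Nat.mod_eq_of_lt (by omega)
        simp [Expr.eval, Op.apply, t14, t15, show f₀ < x + 2 by omega, this]
      · have earg : (2 ^ k + τ.mem 4 (τ.mem 6 x)) % 2 ^ w = 2 ^ k + τ.mem 4 (τ.mem 6 x) := by
          have : τ.mem 4 (τ.mem 6 x) < 2 ^ k := dr.node.2.2.1
          exact Nat.mod_eq_of_lt (by omega)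
        have e1 : 1 % 2 ^ w = 1 := Nat.mod_eq_of_lt (by omega)
        have hx0 : x % 2 ^ w = x := Nat.mod_eq_of_lt (by omega)
        obtain ⟨ρ, hρ⟩ : ∃ ρ, upBody.step w τ = ρ := ⟨_, rfl⟩
        have hmem : (∀ X i, i ≠ x → ρ.mem X i = τ.mem X i) ∧ ρ.mem valArr x = τ.mem valArr x ∧
            ρ.mem leftArr x = τ.mem leftArr x ∧ ρ.mem rightArr x = τ.mem rightArr x ∧
            ρ.mem minArr x = (if τ.mem minArr (τ.mem rightArr x) < τ.mem minArr (τ.mem leftArr x)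
              then τ.mem minArr (τ.mem rightArr x) else τ.mem minArr (τ.mem leftArr x)) ∧
            ρ.mem argminArr x =
              (if τ.mem minArr (τ.mem rightArr x) < τ.mem minArr (τ.mem leftArr x)
              then 2 ^ k + τ.mem argminArr (τ.mem rightArr x)
              else τ.mem argminArr (τ.mem leftArr x)) ∧
            ρ.reg 14 = f₀ ∧ ρ.reg 15 = x ∧ ρ.reg 11 = 2 ^ (k + 1) ∧ ρ.reg 4 = τ.reg 4 := by
          rw [← hρ]
          by_cases hlt : τ.mem 3 (τ.mem 6 x) < τ.mem 3 (τ.mem 5 x)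
          · simp [upBody, Cmd.step, Expr.eval, Op.apply, t14, t15, t11, e2, es, hlt, earg,
              e1, nr, hx0]
            intro X i hi
            simp [hi]
          · simp [upBody, Cmd.step, Expr.eval, Op.apply, t14, t15, t11, e2, es, hlt,
              nl, hx0]
            intro X i hi
            simp [hi]
        rw [hρ]
        obtain ⟨m₁, m₂, m₃, m₄, m₅, m₆, m₇, m₈, m₉, m₁₀⟩ := hmem
        refine h ρ m₇ m₈ m₉ (by rw [m₁₀, t4]) ?_ ?_
        · have hcopy : ∀ {r A}, Dag τ.mem ht (x + 2 * (k + 1) + 1) k r A →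
              Dag ρ.mem ht (x + 2 * (k + 1) + 1) k r A := fun d =>
            d.transfer le_rfl (fun X _ _ i _ hi' => m₁ X i fun e => by rw [e, d₁] at hi'; omega)
              (fun _ _ => rfl) fun _ _ => rfl
          exact Dag.join dl dr (by omega) d₁ (by rw [m₂, tm _ _ (by omega), d₂]) m₃ m₄ m₅ m₆
            (hcopy dl) (hcopy dr)
        · intro X i hi
          rw [m₁ _ _ (by omega), tm _ _ (by omega)]
    have sib : ∀ {τ : State} {A}, (∀ X, ∀ i < x + 2, τ.mem X i = σ.mem X i) →
        Dag σ.mem ht (x + 2) k (x + 1) A → Dag τ.mem ht (x + 2 * (k + 1) + 1) k (x + 1) A :=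
      fun tm d => d.transfer (by omega) (fun X _ _ i hi _ => tm X i hi) (fun _ _ => rfl)
        fun _ _ => rfl
    have hT : (k + 1) * 60 + T' = k * 60 + (60 + T') := by ring
    rw [hT]
    rcases d₃ with ⟨l, r, dp, ds⟩ | ⟨l, r, ds, dp⟩
    · refine ih hf (by omega) (by omega) hs dp (by omega) (by omega) ?_
      intro τ t14 t15 t11 t4 dτ tm
      refine main τ t14 t15 t11 t4 tm ?_ ?_
      · rwa [tm _ _ (by omega), l, show x + 2 * (k + 1) + 1 = x + 2 + 2 * k + 1 by ring]
      · rw [tm _ _ (by omega), r]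
        exact sib tm ds
    · refine ih hf (by omega) (by omega) hs dp (by omega) (by omega) ?_
      intro τ t14 t15 t11 t4 dτ tm
      refine main τ t14 t15 t11 t4 tm ?_ ?_
      · rw [tm _ _ (by omega), l]
        exact sib tm ds
      · rwa [tm _ _ (by omega), r, show x + 2 * (k + 1) + 1 = x + 2 + 2 * k + 1 by ring]

/-- Makes a root for the sequence that agrees with `r8` plus the sequence of node `r6` on the
positions before `r10`, and with `r9` plus the sequence of node `r7` on the others; `r17` is the
length of these sequences. -/
def spliceCmd : Cmd :=
  (11 ::= .reg 17 ;; 14 ::= .reg 4) ;; downCmd ;; upCmd ;; 3 ::= .reg 14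

theorem spliceCmd_runs {w h p q ap aq pos f : ℕ} {ht Ap Aq : ℕ → ℕ} {σ : State}
    (hS : σ.reg 17 = 2 ^ h) (hp : σ.reg 6 = p) (hq : σ.reg 7 = q) (hap : σ.reg 8 = ap)
    (haq : σ.reg 9 = aq) (hpos : σ.reg 10 = pos) (hf : σ.reg 4 = f)
    (dp : Dag σ.mem ht f h p Ap) (dq : Dag σ.mem ht f h q Aq) (hlt : pos < 2 ^ h)
    (hw : f + 2 * h + 1 < 2 ^ w) (hhw : 2 ^ h < 2 ^ w)
    (hwp : ∀ a < 2 ^ h, Ap a + ap < 2 ^ w) (hwq : ∀ a < 2 ^ h, Aq a + aq < 2 ^ w) :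
    Runs w spliceCmd σ (160 * (h + 1)) fun τ => τ.reg 4 = f + 2 * h + 1 ∧
      ∃ ht', Dag τ.mem ht' (f + 2 * h + 1) h (τ.reg 3)
          (fun a => if a < pos then Ap a + ap else Aq a + aq) ∧
        (∀ i < f, ht' i = ht i) ∧ ∀ X, ∀ i < f, τ.mem X i = σ.mem X i := by
  -- the new nodes are, in the order of allocation, of heights `h, h - 1, h - 1, h - 2, h - 2, …`
  set ht' : ℕ → ℕ := fun z => if z < f then ht z else h - (z - f + 1) / 2 with hht'
  have hold : ∀ i < f, ht' i = ht i := fun i hi => by simp [hht', hi]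
  have trans : ∀ {r A}, Dag σ.mem ht f h r A → Dag σ.mem ht' f h r A := fun d =>
    d.transfer le_rfl (fun _ _ _ _ _ _ => rfl) hold fun _ _ => rfl
  refine (Runs.seq (T := 4) (T' := (h * 100 + 40) + (h * 60 + 4 + 2)) (Runs.of_step rfl (by decide)
    (Runs.seq ?_))).mono (by omega) fun _ => id
  refine ((downCmd_runs (w := w) (ht := ht') h
    (σ := Cmd.step w (11 ::= .reg 17 ;; 14 ::= .reg 4) σ)
    (B := fun a => if a < pos then Ap a + ap else Aq a + aq) (f := f) ?_ ?_ ?_ ?_ ?_ ?_ ?_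
    (trans dp) (trans dq) hlt hw hhw (fun _ _ => rfl) hwp hwq ?_ ?_).frame).mono le_rfl ?_
  any_goals simp [Cmd.step, Expr.eval, hS, hp, hq, hap, haq, hpos, hf]
  · intro i hi
    simp only [hht']
    rw [if_neg (by omega)]; omega
  · intro i hi
    simp only [hht']
    rw [if_neg (by omega)]; omega
  · rintro τ hd t4 t15 t11 tm tr -
    have t14 : τ.reg 14 = f := by
      rw [tr 14 (by decide)]; simp
    refine Runs.seq ?_
    refine upCmd_runs h t14 le_rfl t15 t11 hd (by omega) hhw ?_
    intro ρ r14 r15 r11 r4 hdag rm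
    refine Runs.while_done ?_ (Runs.of_step rfl (by decide) ?_)
    · simp [Expr.eval, Op.apply, r14, r15]
    · refine ⟨?_, ht', ?_, hold, fun X i hi => ?_⟩
      · simp [Cmd.step, r4, t4]
      · simpa [Cmd.step, Expr.eval, r14] using hdag
      · simp [Cmd.step, rm X i hi, tm X i hi]

/-- `Stores` in terms of `Dag`; registers 5, 4 and 3 hold the height, the first free node and the
root. -/
theorem stores_iff {σ : State} {h : ℕ} {A : ℕ → ℕ} :
    Stores σ h A ↔ σ.reg 5 = h ∧ ∃ ht, Dag σ.mem ht (σ.reg 4) h (σ.reg 3) A := by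
  simp only [Stores, isDag_iff_dag]

theorem Stores.transfer {σ τ : State} {h : ℕ} {A B : ℕ → ℕ} (hσ : Stores σ h A)
    (hm : ∀ X, 2 ≤ X → X ≤ 6 → τ.mem X = σ.mem X) (h3 : τ.reg 3 = σ.reg 3)
    (h4 : τ.reg 4 = σ.reg 4) (h5 : τ.reg 5 = σ.reg 5) (hA : ∀ a < 2 ^ h, B a = A a) :
    Stores τ h B := by
  rw [stores_iff] at hσ ⊢
  obtain ⟨hh, ht, hd⟩ := hσ
  refine ⟨by rw [h5, hh], ht, ?_⟩
  rw [h3, h4]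
  exact hd.transfer le_rfl (fun X a b i _ _ => by rw [hm X a b]) (fun _ _ => rfl) hA

/-! ### The operations -/

/-- *Initialize*: the node `0` is a leaf of value `0`. -/
def initCmd : Cmd :=
  3 ::= .const 0 ;; 4 ::= .const 1 ;; 5 ::= .const 0 ;;
  .store valArr (.const 0) (.const 0) ;; .store minArr (.const 0) (.const 0) ;;
  .store argminArr (.const 0) (.const 0)

/-- Computes the length `2 ^ h` of the array from its height. -/
def powerLoop : Cmd :=
  .while (.reg 18 ⊏ .reg 5) (17 ::= .reg 17 ⊠ .const 2 ;; 18 ::= .reg 18 ⊞ .const 1)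

/-- The range update splices twice: `A` before `ℓ` with `A + 1` after it, and the result before `r`
with the old `A` after it. -/
def addCmd : Cmd :=
  .ite (.reg 1 ⊏ .reg 2)
    ((17 ::= .const 1 ;; 18 ::= .const 0) ;; powerLoop ;;
      (16 ::= .reg 3 ;; 6 ::= .reg 3 ;; 7 ::= .reg 3 ;; 8 ::= .const 0 ;; 9 ::= .const 1 ;;
        10 ::= .reg 1) ;; spliceCmd ;;
      .ite (.reg 2 ⊏ .reg 17)
        ((6 ::= .reg 3 ;; 7 ::= .reg 16 ;; 8 ::= .const 0 ;; 9 ::= .const 0 ;; 10 ::= .reg 2) ;;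
          spliceCmd)
        .skip)
    .skip

/-- *Extend*: a new root of which both children are the old root. -/
def extCmd : Cmd :=
  .store valArr (.reg 4) (.const 0) ;;
  .store minArr (.reg 4) (.load minArr (.reg 3)) ;;
  .store argminArr (.reg 4) (.load argminArr (.reg 3)) ;;
  .store leftArr (.reg 4) (.reg 3) ;;
  .store rightArr (.reg 4) (.reg 3) ;;
  3 ::= .reg 4 ;;
  4 ::= .reg 4 ⊞ .const 1 ;;
  5 ::= .reg 5 ⊞ .const 1

/-- *Argmin*. -/
def argCmd : Cmd := 0 ::= .load argminArr (.reg 3)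

theorem initCmd_runs {w : ℕ} (hw : 1 < 2 ^ w) (σ : State) :
    Runs w initCmd σ 15 fun τ => Stores τ 0 (fun _ => 0) ∧ τ.reg 4 = 1 := by
  refine Runs.of_step rfl (by decide) ?_
  simp [stores_iff, Dag, initCmd, Cmd.step, Expr.eval, Nat.mod_eq_of_lt hw]
  exact ⟨fun _ => 0, rfl⟩

theorem argCmd_runs {w : ℕ} {σ : State} {h : ℕ} {A : ℕ → ℕ} (hσ : Stores σ h A) :
    Runs w argCmd σ 3 fun τ => Stores τ h A ∧ τ.reg 4 = σ.reg 4 ∧ τ.reg 3 = σ.reg 3 ∧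
      τ.mem = σ.mem ∧ τ.reg 0 = σ.mem argminArr (σ.reg 3) ∧ τ.reg 0 < 2 ^ h ∧
      ∀ a < 2 ^ h, A (τ.reg 0) ≤ A a := by
  refine Runs.of_step rfl (by decide) ⟨?_, ?_⟩
  · exact hσ.transfer (fun _ _ _ => rfl) (by simp [argCmd, Cmd.step]) (by simp [argCmd, Cmd.step])
      (by simp [argCmd, Cmd.step]) fun _ _ => rfl
  · obtain ⟨-, ht, hd⟩ := stores_iff.1 hσ
    obtain ⟨-, -, h₁, h₂, h₃, -⟩ := hd.node
    simp [argCmd, Cmd.step, Expr.eval]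
    exact ⟨h₁, fun a ha => h₂.trans_le (h₃ a ha)⟩

theorem extCmd_runs {w : ℕ} {σ : State} {h : ℕ} {A : ℕ → ℕ} (hσ : Stores σ h A)
    (hw : σ.reg 4 + 1 < 2 ^ w) (hh : h + 1 < 2 ^ w) :
    Runs w extCmd σ 40 fun τ => Stores τ (h + 1) (fun a => A (a % 2 ^ h)) ∧
      τ.reg 4 = σ.reg 4 + 1 := by
  refine Runs.of_step rfl (by decide) ?_
  obtain ⟨h₁, ht, hd⟩ := stores_iff.1 hσ
  obtain ⟨hr, hhr, d₁, d₂, d₃, d₄⟩ := hd.node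
  have e1 : 1 % 2 ^ w = 1 := Nat.mod_eq_of_lt (by omega)
  have hk0 : 0 < 2 ^ h := by positivity
  have hk2 : 2 ^ (h + 1) = 2 ^ h + 2 ^ h := by rw [pow_succ]; omega
  have hne : σ.reg 3 ≠ σ.reg 4 := by omega
  obtain ⟨ρ, hρ⟩ : ∃ ρ, extCmd.step w σ = ρ := ⟨_, rfl⟩
  have hmem : (∀ X, ∀ i < σ.reg 4, ρ.mem X i = σ.mem X i) ∧ ρ.mem valArr (σ.reg 4) = 0 ∧
      ρ.mem minArr (σ.reg 4) = σ.mem minArr (σ.reg 3) ∧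
      ρ.mem argminArr (σ.reg 4) = σ.mem argminArr (σ.reg 3) ∧
      ρ.mem leftArr (σ.reg 4) = σ.reg 3 ∧ ρ.mem rightArr (σ.reg 4) = σ.reg 3 ∧
      ρ.reg 3 = σ.reg 4 ∧ ρ.reg 4 = σ.reg 4 + 1 ∧ ρ.reg 5 = h + 1 := by
    rw [← hρ]
    simp [extCmd, Cmd.step, Expr.eval, Op.apply, e1, Nat.mod_eq_of_lt hw, h₁,
      Nat.mod_eq_of_lt hh, hne]
    intro X i hi
    simp [hi.ne]
  obtain ⟨m₁, m₂, m₃, m₄, m₅, m₆, m₇, m₈, m₉⟩ := hmem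
  rw [hρ]
  refine ⟨stores_iff.2 ⟨m₉, fun i => if i = σ.reg 4 then h + 1 else ht i, ?_⟩, m₈⟩
  have old : ∀ B : ℕ → ℕ, (∀ a < 2 ^ h, B a = A a) → Dag ρ.mem
      (fun i => if i = σ.reg 4 then h + 1 else ht i) (σ.reg 4 + 1) h (σ.reg 3) B := fun B hB =>
    hd.transfer (by omega) (fun X _ _ i hi _ => m₁ X i hi) (fun i hi => by simp [hi.ne]) hB
  rw [m₇, m₈]
  simp only [Dag]
  rw [m₂, m₃, m₄, m₅, m₆]
  refine ⟨by omega, by simp, by omega, ?_, fun a ha => d₃ _ (Nat.mod_lt _ hk0),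
    fun a ha => Nat.zero_le _, old _ fun a ha => ?_, old _ fun a ha => ?_⟩
  · rw [Nat.mod_eq_of_lt d₁, d₂]
  · simp [Nat.mod_eq_of_lt ha]
  · simp [Nat.mod_eq_of_lt ha]

theorem powerLoop_runs {w h : ℕ} {σ : State} (h5 : σ.reg 5 = h) (h17 : σ.reg 17 = 1)
    (h18 : σ.reg 18 = 0) (hw : 2 ^ h < 2 ^ w) :
    Runs w powerLoop σ (12 * h + 4) fun τ => τ.reg 17 = 2 ^ h := by
  have hh : h < 2 ^ h := Nat.lt_two_pow_self
  have := Runs.while_count (w := w) (b := .reg 18 ⊏ .reg 5)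
    (c := 17 ::= .reg 17 ⊠ .const 2 ;; 18 ::= .reg 18 ⊞ .const 1) (T := 8)
    (fun k τ => τ.reg 5 = h ∧ τ.reg 17 = 2 ^ k ∧ τ.reg 18 = k) h ?_ ?_ (σ := σ) ⟨h5, h17, h18⟩
  · refine this.mono (by simp only [Expr.cost]; omega) ?_
    rintro τ ⟨-, h, -⟩
    exact h
  · rintro k hk τ ⟨t5, t17, t18⟩
    have hk' : 2 ^ (k + 1) ≤ 2 ^ h := Nat.pow_le_pow_right (by omega) hk
    have hk2 : 2 ^ k * 2 = 2 ^ (k + 1) := (pow_succ 2 k).symm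
    have hk0 : 0 < 2 ^ k := by positivity
    have e1 : 1 % 2 ^ w = 1 := Nat.mod_eq_of_lt (by omega)
    have e2 : 2 % 2 ^ w = 2 := Nat.mod_eq_of_lt (by omega)
    refine ⟨by simp [Expr.eval, Op.apply, t5, t18, hk, e1], Runs.of_step rfl (by decide) ?_⟩
    simp [Cmd.step, Expr.eval, Op.apply, t5, t17, t18, e1, e2, hk2,
      Nat.mod_eq_of_lt (hk'.trans_lt hw)]
    exact Nat.mod_eq_of_lt (by omega)
  · rintro τ ⟨t5, t17, t18⟩
    simp [Expr.eval, Op.apply, t5, t18]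

theorem addCmd_runs {w : ℕ} {σ : State} {h : ℕ} {A : ℕ → ℕ} (hσ : Stores σ h A)
    (hle : σ.reg 1 ≤ σ.reg 2) (hle' : σ.reg 2 ≤ 2 ^ h) (hw : σ.reg 4 + 4 * (h + 1) ≤ 2 ^ w)
    (hhw : 2 ^ h < 2 ^ w) (hA : ∀ a < 2 ^ h, A a + 1 < 2 ^ w) :
    Runs w addCmd σ (400 * (h + 1)) fun τ =>
      Stores τ h (fun a => if σ.reg 1 ≤ a ∧ a < σ.reg 2 then A a + 1 else A a) ∧
      τ.reg 4 ≤ σ.reg 4 + 4 * (h + 1) := by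
  have hk0 : 0 < 2 ^ h := by positivity
  have e1 : 1 % 2 ^ w = 1 := Nat.mod_eq_of_lt (by omega)
  refine (Runs.ite (T := 4 + (12 * h + 4 + (12 + (160 * (h + 1) + (4 + (10 + 160 * (h + 1)))))))
    (fun hb => ?_) (fun hb => ?_)).mono (by simp only [Expr.cost]; omega) fun _ => id
  swap
  · have hlt : ¬ σ.reg 1 < σ.reg 2 := fun hlt => by
      simp [Expr.eval, Op.apply, hlt, e1] at hb
    refine Runs.of_step rfl (by simp only [Cmd.bound]; omega) ⟨?_, by simp [Cmd.step]⟩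
    exact hσ.transfer (fun _ _ _ => rfl) rfl rfl rfl fun a _ => by simp; omega
  have hlt : σ.reg 1 < σ.reg 2 := by
    by_contra hlt
    simp [Expr.eval, Op.apply, hlt] at hb
  obtain ⟨h5, ht, hd⟩ := stores_iff.1 hσ
  refine Runs.seq (Runs.of_step rfl (by decide) (Runs.seq ?_))
  refine (powerLoop_runs (h := h) (by simp [Cmd.step, h5]) (by simp [Cmd.step, Expr.eval, e1])
    (by simp [Cmd.step, Expr.eval]) hhw).frame.mono le_rfl ?_
  rintro σ₁ ⟨s17, sr, sm⟩
  replace sr : ∀ r < 6, σ₁.reg r = σ.reg r := fun r hr => by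
    rw [sr r (by simp [powerLoop, Cmd.regs]; omega)]
    simp [Cmd.step, show r ≠ 17 by omega, show r ≠ 18 by omega]
  replace sm : σ₁.mem = σ.mem := by
    funext X
    rw [sm X (by simp [powerLoop, Cmd.arrs])]
    simp [Cmd.step]
  refine Runs.seq (Runs.of_step rfl (by decide) (Runs.seq ?_))
  refine (spliceCmd_runs (f := σ.reg 4) (h := h) (ht := ht) (Ap := A) (Aq := A)
    (pos := σ.reg 1) (p := σ.reg 3) (q := σ.reg 3) (ap := 0) (aq := 1)
    ?_ ?_ ?_ ?_ ?_ ?_ ?_ ?_ ?_ ?_ ?_ ?_ ?_ ?_).frame.mono le_rfl ?_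
  any_goals first
    | exact hd
    | (simp [Cmd.step, Expr.eval, s17, sr, sm, e1]; done)
    | omega
  · simpa [Cmd.step, sm] using hd
  · simpa [Cmd.step, sm] using hd
  · intro a ha; have := hA a ha; omega
  rintro σ₂ ⟨⟨u4, ht₂, hd₂, hht₂, um⟩, ur, -⟩
  have u17 : σ₂.reg 17 = 2 ^ h := by rw [ur 17 (by decide)]; simp [Cmd.step, s17]
  have u16 : σ₂.reg 16 = σ.reg 3 := by
    rw [ur 16 (by decide)]; simp [Cmd.step, Expr.eval, sr]
  have u2 : σ₂.reg 2 = σ.reg 2 := by rw [ur 2 (by decide)]; simp [Cmd.step, sr]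
  have u5 : σ₂.reg 5 = h := by rw [ur 5 (by decide)]; simp [Cmd.step, sr, h5]
  simp only [Cmd.step, State.setReg_mem, sm] at um
  refine (Runs.ite (T := 10 + 160 * (h + 1)) (fun hb => ?_) (fun hb => ?_)).mono
    (by simp only [Expr.cost]; omega) fun _ => id
  · have hlt₂ : σ.reg 2 < 2 ^ h := by
      by_contra hlt
      simp [Expr.eval, Op.apply, u2, u17, hlt] at hb
    refine Runs.seq (Runs.of_step rfl (by decide) ?_)
    refine (spliceCmd_runs (f := σ.reg 4 + 2 * h + 1) (h := h) (ht := ht₂) (Aq := A)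
      (Ap := fun a => if a < σ.reg 1 then A a + 0 else A a + 1)
      (pos := σ.reg 2) (p := σ₂.reg 3) (q := σ.reg 3) (ap := 0) (aq := 0)
      ?_ ?_ ?_ ?_ ?_ ?_ ?_ ?_ ?_ ?_ ?_ ?_ ?_ ?_).frame.mono le_rfl ?_
    any_goals first
      | (simp [Cmd.step, Expr.eval, u17, u16, u2, u4]; done)
      | omega
    · simpa [Cmd.step] using hd₂
    · simp only [Cmd.step, State.setReg_mem]
      exact hd.transfer (by omega) (fun X _ _ i hi _ => um X i hi) hht₂ fun _ _ => rfl
    · intro a ha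
      have := hA a ha
      split_ifs <;> omega
    · intro a ha; have := hA a ha; omega
    · rintro σ₃ ⟨⟨v4, ht₃, hd₃, -, -⟩, vr, -⟩
      refine ⟨stores_iff.2 ⟨?_, ht₃, ?_⟩, by omega⟩
      · rw [vr 5 (by decide)]; simp [Cmd.step, u5]
      · rw [v4]
        refine hd₃.transfer le_rfl (fun _ _ _ _ _ _ => rfl) (fun _ _ => rfl) fun a _ => ?_
        split_ifs <;> omega
  · have hlt₂ : ¬ σ.reg 2 < 2 ^ h := fun hlt => by
      simp [Expr.eval, Op.apply, u2, u17, hlt, e1] at hb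
    refine Runs.of_step rfl (by simp only [Cmd.bound]; omega) ?_
    refine ⟨stores_iff.2 ⟨u5, ht₂, ?_⟩, ?_⟩
    · simp only [Cmd.step]
      rw [u4]
      refine hd₂.transfer le_rfl (fun _ _ _ _ _ _ => rfl) (fun _ _ => rfl) fun a _ => ?_
      split_ifs <;> omega
    · simp only [Cmd.step]; omega

theorem implements {C : ℕ} (hC : 400 ≤ C) : Implements C initCmd addCmd extCmd argCmd := by
  have out : ∀ {w c σ T} {Q : State → Prop} {T'}, Runs w c σ T Q → T ≤ T' →
      ∃ t τ, Exec w c σ t τ ∧ t ≤ T' ∧ Q τ := fun h hT => h.mono hT fun _ => id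
  have hmul : ∀ h, 400 * (h + 1) ≤ C * (h + 1) := fun h => Nat.mul_le_mul_right _ hC
  have hpow : ∀ h, 400 * 2 ^ h ≤ C * 2 ^ h := fun h => Nat.mul_le_mul_right _ hC
  refine ⟨fun w σ hw => ?_, fun w σ h A hσ hroom hle hle' => ?_, fun w σ h A hσ hroom => ?_,
    fun w σ h A hσ hroom => ?_⟩
  · exact out ((initCmd_runs (by omega) σ).mono le_rfl fun τ hτ => ⟨hτ.1, by
      have := hτ.2; show τ.reg 4 ≤ C; omega⟩) (by omega)
  · obtain ⟨h₁, h₂, h₃⟩ := hroom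
    have := hmul h; have := hpow h
    have : 0 < 2 ^ h := by positivity
    exact out ((addCmd_runs hσ hle hle' (by change σ.reg 4 + _ ≤ _ at h₁; omega) (by omega)
      h₃).mono le_rfl fun τ hτ => ⟨hτ.1, hτ.2.trans (by show σ.reg 4 + _ ≤ σ.reg 4 + _; omega)⟩)
      (by omega)
  · obtain ⟨h₁, h₂, h₃⟩ := hroom
    have := hmul h; have := hpow h
    have : h < 2 ^ h := Nat.lt_two_pow_self
    exact out ((extCmd_runs hσ (by change σ.reg 4 + _ ≤ _ at h₁; omega) (by omega)).mono le_rfl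
      fun τ hτ => ⟨hτ.1, by have := hτ.2; show τ.reg 4 ≤ σ.reg 4 + C; omega⟩) (by omega)
  · exact out ((argCmd_runs hσ).mono le_rfl
      fun τ hτ => ⟨hτ.1, hτ.2.1, hτ.2.2.2.2.1, hτ.2.2.2.2.2⟩) (by omega)

/-! ### The trie measure of a set of binary representations -/

theorem length_bits (L x : ℕ) : (bits L x).length = L := by
  induction L with
  | zero => rfl
  | succ L ih => simp [bits, ih]

theorem mod_div_eq_iff (L j x y : ℕ) :
    x % 2 ^ L / 2 ^ j = y % 2 ^ L / 2 ^ j ↔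
      ∀ i, j ≤ i → i < L → x.testBit i = y.testBit i := by
  constructor
  · intro h i hi hiL
    have := congrArg (fun z => z.testBit (i - j)) h
    simpa [Nat.testBit_div_two_pow, Nat.testBit_mod_two_pow, hi, hiL] using this
  · intro h
    refine Nat.eq_of_testBit_eq fun i => ?_
    simp only [Nat.testBit_div_two_pow, Nat.testBit_mod_two_pow]
    by_cases hi : i + j < L
    · rw [h (i + j) (by omega) hi]
    · simp [hi]

/-- The length of `bits L x ⊕ bits L y` is the number of block sizes `2 ^ j`, `j < L`, for which
`x` and `y` lie in different blocks. -/
theorem length_oplus_bits (L x y : ℕ) : (oplus (bits L x) (bits L y)).length =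
    ∑ j ∈ Finset.range L, if x % 2 ^ L / 2 ^ j = y % 2 ^ L / 2 ^ j then 0 else 1 := by
  induction L with
  | zero => simp [bits, oplus]
  | succ L ih =>
    simp only [bits, oplus]
    split_ifs with hb
    · rw [ih, Finset.sum_range_succ, if_pos, add_zero]
      · refine Finset.sum_congr rfl fun j hj => if_congr ?_ rfl rfl
        simp only [mod_div_eq_iff]
        refine forall_congr' fun i => forall_congr' fun hji => ⟨fun h hi => ?_, fun h hi => h (by omega)⟩
        rcases Nat.lt_succ_iff_lt_or_eq.1 hi with hi | rfl
        · exact h hi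
        · exact hb
      · rw [mod_div_eq_iff]
        intro i h₁ h₂
        obtain rfl : i = L := by omega
        exact hb
    · rw [List.length_cons, length_bits, Finset.sum_congr rfl (g := fun _ => 1)]
      · simp
      · intro j hj
        rw [if_neg]
        rw [mod_div_eq_iff]
        have := Finset.mem_range.1 hj
        exact fun h => hb (h L (by omega) (by omega))

theorem bits_lt_bits (L : ℕ) {x y : ℕ} (h : x % 2 ^ L < y % 2 ^ L) : bits L x < bits L y := by
  induction L with
  | zero => simp [Nat.mod_one] at h
  | succ L ih =>
    have key : ∀ z, z % 2 ^ (L + 1) = z % 2 ^ L + 2 ^ L * (z.testBit L).toNat := fun z => by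
      rw [Nat.mod_pow_succ, Nat.testBit_eq_decide_div_mod_eq]
      rcases Nat.mod_two_eq_zero_or_one (z / 2 ^ L) with h | h <;> simp [h]
    have hx : x % 2 ^ L < 2 ^ L := Nat.mod_lt _ (by positivity)
    have hy : y % 2 ^ L < 2 ^ L := Nat.mod_lt _ (by positivity)
    rw [key, key] at h
    simp only [bits, List.cons_lt_cons_iff]
    cases hxb : x.testBit L <;> cases hyb : y.testBit L <;> simp [hxb, hyb] at h ⊢
    · exact ih h
    · omega
    · exact ih h

theorem sort_image_bits (L : ℕ) (T : Finset ℕ) (hT : ∀ x ∈ T, x < 2 ^ L) :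
    (T.image (bits L)).sort (· ≤ ·) = (T.sort (· ≤ ·)).map (bits L) := by
  have hlt : ∀ x ∈ T, ∀ y ∈ T, x < y → bits L x < bits L y := fun x hx y hy hxy =>
    bits_lt_bits L (by rwa [Nat.mod_eq_of_lt (hT x hx), Nat.mod_eq_of_lt (hT y hy)])
  have hinj : Set.InjOn (bits L) T := by
    intro x hx y hy hxy
    rcases lt_trichotomy x y with h | h | h
    · exact absurd hxy (hlt x hx y hy h).ne
    · exact h
    · exact absurd hxy (hlt y hy x hx h).ne'
  have hnd : ((T.sort (· ≤ ·)).map (bits L)).Nodup :=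
    (T.sort_nodup (· ≤ ·)).map_on fun x hx y hy =>
      hinj ((T.mem_sort _).1 hx) ((T.mem_sort _).1 hy)
  have hset : T.image (bits L) = ((T.sort (· ≤ ·)).map (bits L)).toFinset := by
    ext; simp
  rw [hset]
  refine List.Perm.eq_of_pairwise' (r := (· ≤ ·)) (Finset.pairwise_sort _ _) ?_ ?_
  · rw [List.pairwise_map]
    refine (T.pairwise_sort (· ≤ ·)).imp_of_mem fun hx hy hxy => ?_
    rcases hxy.eq_or_lt with h | h
    · rw [h]
    · exact (hlt _ ((T.mem_sort _).1 hx) _ ((T.mem_sort _).1 hy) h).le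
  · exact (List.perm_ext_iff_of_nodup (Finset.sort_nodup _ _) hnd).2 fun x => by simp

/-- The trie measure counts, for every block size, the blocks that contain an element. -/
theorem listTrie_map_bits (L : ℕ) (l : List ℕ) (hl : l.Pairwise (· < ·))
    (hL : ∀ x ∈ l, x < 2 ^ L) : listTrie (l.map (bits L)) =
      ∑ j ∈ Finset.range L, (l.toFinset.image (· / 2 ^ j)).card := by
  induction l with
  | nil => simp [listTrie]
  | cons x l ih =>
    rcases l with _ | ⟨y, l⟩
    · simp [listTrie, sumOplus, length_bits]
    · have ih' := ih hl.of_cons fun z hz => hL z (List.mem_cons_of_mem _ hz)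
      have hxy : x < y := List.rel_of_pairwise_cons hl (by simp)
      have : listTrie ((x :: y :: l).map (bits L)) =
          listTrie ((y :: l).map (bits L)) + (oplus (bits L x) (bits L y)).length := by
        simp only [List.map_cons, listTrie, sumOplus, length_bits]
        omega
      rw [this, ih', length_oplus_bits, ← Finset.sum_add_distrib]
      refine Finset.sum_congr rfl fun j _ => ?_
      rw [Nat.mod_eq_of_lt (hL x (by simp)), Nat.mod_eq_of_lt (hL y (by simp)),
        List.toFinset_cons (a := x), Finset.image_insert]
      split_ifs with h
      · rw [Finset.insert_eq_of_mem, add_zero]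
        exact Finset.mem_image.2 ⟨y, by simp, h.symm⟩
      · rw [Finset.card_insert_of_notMem]
        intro hmem
        obtain ⟨z, hz, hzx⟩ := Finset.mem_image.1 hmem
        have hyz : y ≤ z := by
          rcases List.mem_cons.1 (List.mem_toFinset.1 hz) with rfl | hz
          · exact le_rfl
          · exact (List.rel_of_pairwise_cons hl.of_cons hz).le
        have h₁ := Nat.div_le_div_right (c := 2 ^ j) hxy.le
        have h₂ := Nat.div_le_div_right (c := 2 ^ j) hyz
        omega

theorem trie_image_bits (L : ℕ) (T : Finset ℕ) (hT : ∀ x ∈ T, x < 2 ^ L) :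
    trie (T.image (bits L)) = ∑ j ∈ Finset.range L, (T.image (· / 2 ^ j)).card := by
  rw [trie, sort_image_bits L T hT, listTrie_map_bits L _ (T.sortedLT_sort.pairwise)
    fun x hx => hT x ((T.mem_sort _).1 hx), Finset.sort_toFinset]

/-! ### Counting blocks by gaps -/

/-- The cyclic distance, in `{1, …, u}`, from the element `y` of `S ⊆ {0, …, u - 1}` down to its
predecessor in `S`; it is `u` if `S = {y}`. -/
noncomputable def gap (u : ℕ) (S : Finset ℕ) (y : ℕ) : ℕ :=
  sInf {d | 0 < d ∧ (y + u - d) % u ∈ S}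

theorem gap_spec {u y : ℕ} {S : Finset ℕ} (hy : y ∈ S) (hyu : y < u) :
    0 < gap u S y ∧ gap u S y ≤ u ∧ (y + u - gap u S y) % u ∈ S ∧
      ∀ d, 0 < d → d < gap u S y → (y + u - d) % u ∉ S := by
  have hu : u ∈ {d | 0 < d ∧ (y + u - d) % u ∈ S} :=
    ⟨by omega, by rwa [Nat.add_sub_cancel, Nat.mod_eq_of_lt hyu]⟩
  have h := Nat.sInf_mem ⟨u, hu⟩
  exact ⟨h.1, Nat.sInf_le hu, h.2, fun d hd hlt hmem => Nat.notMem_of_lt_sInf hlt ⟨hd, hmem⟩⟩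

theorem eq_gap {u y g : ℕ} {S : Finset ℕ} (hg : 0 < g) (hgu : g ≤ u) (hyu : y < u)
    (hmem : (y + u - g) % u ∈ S) (h₁ : ∀ z ∈ S, z < y → g ≤ y - z)
    (h₂ : ∀ z ∈ S, y ≤ z → g ≤ y + u - z) : g = gap u S y := by
  refine le_antisymm (le_csInf ⟨g, hg, hmem⟩ ?_) (Nat.sInf_le ⟨hg, hmem⟩)
  rintro d ⟨hd, hdS⟩
  by_contra hlt
  rcases lt_or_ge d (y + 1) with h | h
  · rw [show y + u - d = (y - d) + u by omega, Nat.add_mod_right,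
      Nat.mod_eq_of_lt (by omega)] at hdS
    have := h₁ _ hdS (by omega)
    omega
  · rw [Nat.mod_eq_of_lt (by omega)] at hdS
    have := h₂ _ hdS (by omega)
    omega

/-- After the shift by `a`, the element `y` is the first one of its block of size `s` if and only
if its offset in the block is less than its gap. -/
theorem first_in_block_iff {u s a y : ℕ} {S : Finset ℕ} (hsu : s ∣ u) (hS : ∀ x ∈ S, x < u)
    (hy : y ∈ S) : (y + a) % s < gap u S y ↔
      ∀ z ∈ S, (z + a) % u / s = (y + a) % u / s → (y + a) % u ≤ (z + a) % u := by
  obtain ⟨g₁, g₂, g₃, g₄⟩ := gap_spec hy (hS y hy)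
  set g := gap u S y
  have hu : 0 < u := by omega
  have hs : 0 < s := Nat.pos_of_dvd_of_pos hsu hu
  have hdec := Nat.div_add_mod ((y + a) % u) s
  rw [Nat.mod_mod_of_dvd _ hsu] at hdec
  constructor
  · intro hlt z hz hblock
    by_contra hcon
    push Not at hcon
    have hdecz := Nat.div_add_mod ((z + a) % u) s
    rw [hblock] at hdecz
    have hyu : (y + a) % u < u := Nat.mod_lt _ hu
    refine g₄ ((y + a) % u - (z + a) % u) (by omega) (by omega) ?_
    have hmod : y + u - ((y + a) % u - (z + a) % u) ≡ z [MOD u] := by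
      refine Nat.ModEq.add_right_cancel' (a + ((y + a) % u - (z + a) % u)) ?_
      rw [show y + u - ((y + a) % u - (z + a) % u) + (a + ((y + a) % u - (z + a) % u)) =
        y + a + u by omega, ← Nat.add_assoc]
      calc y + a + u ≡ (y + a) % u [MOD u] := by simp [Nat.ModEq]
        _ = (z + a) % u + ((y + a) % u - (z + a) % u) := by omega
        _ ≡ z + a + ((y + a) % u - (z + a) % u) [MOD u] := (Nat.mod_modEq _ _).add_right _
    rw [hmod, Nat.mod_eq_of_lt (hS z hz)]
    exact hz
  · intro h
    by_contra hcon
    push Not at hcon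
    have hpos : g ≤ (y + a) % u := by
      have : (y + a) % s ≤ (y + a) % u := by omega
      omega
    have hz : ((y + u - g) % u + a) % u = (y + a) % u - g := by
      have hlt : (y + a) % u - g < u := by have := Nat.mod_lt (y + a) hu; omega
      have : (y + u - g) % u + a ≡ (y + a) % u - g [MOD u] := by
        refine Nat.ModEq.add_right_cancel' g ?_
        rw [Nat.sub_add_cancel hpos]
        calc (y + u - g) % u + a + g ≡ (y + u - g) + a + g [MOD u] :=
              ((Nat.mod_modEq _ _).add_right _).add_right _
          _ = y + a + u := by omega
          _ ≡ (y + a) % u [MOD u] := by simp [Nat.ModEq]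
      rw [this, Nat.mod_eq_of_lt hlt]
    have hle := h _ g₃ ?_
    · rw [hz] at hle
      omega
    · rw [hz]
      have := Nat.mod_lt (y + a) hs
      refine Nat.div_eq_of_lt_le ?_ ?_
      · rw [Nat.mul_comm]; omega
      · rw [Nat.succ_mul, Nat.mul_comm]; omega

theorem card_blocks {u s a : ℕ} {S : Finset ℕ} (hsu : s ∣ u) (hS : ∀ x ∈ S, x < u) :
    (S.image fun x => (x + a) % u / s).card =
      ∑ y ∈ S, if (y + a) % s < gap u S y then 1 else 0 := by
  classical
  rw [← Finset.card_filter, ← Finset.card_image_of_injOn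
    (s := S.filter _) (f := fun x => (x + a) % u / s)]
  · congr 1
    refine Finset.Subset.antisymm ?_ (Finset.image_subset_image (Finset.filter_subset _ _))
    intro b hb
    obtain ⟨x, hx, rfl⟩ := Finset.mem_image.1 hb
    obtain ⟨y, hy, hmin⟩ := Finset.exists_min_image
      (S.filter fun z => (z + a) % u / s = (x + a) % u / s) (fun z => (z + a) % u)
      ⟨x, by simp [hx]⟩
    rw [Finset.mem_filter] at hy
    refine Finset.mem_image.2 ⟨y, Finset.mem_filter.2 ⟨hy.1, ?_⟩, hy.2⟩
    rw [first_in_block_iff hsu hS hy.1]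
    exact fun z hz hzy => hmin z (Finset.mem_filter.2 ⟨hz, hzy.trans hy.2⟩)
  · intro x hx y hy hxy
    simp only [Finset.coe_filter, Set.mem_ofPred_eq] at hx hy
    have h₁ := (first_in_block_iff hsu hS hx.1).1 hx.2 y hy.1 hxy.symm
    have h₂ := (first_in_block_iff hsu hS hy.1).1 hy.2 x hx.1 hxy
    have hmod : x + a ≡ y + a [MOD u] := le_antisymm h₁ h₂
    have := hmod.add_right_cancel'
    rwa [Nat.ModEq, Nat.mod_eq_of_lt (hS x hx.1), Nat.mod_eq_of_lt (hS y hy.1)] at this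

/-- The shifted trie measure of one set. At block size `2 ^ j` it depends on the shift modulo
`2 ^ j` only. -/
theorem trie_image_shiftEnc (L a : ℕ) (S : Finset ℕ) (hS : ∀ x ∈ S, x < 2 ^ L) :
    trie (S.image (shiftEnc L a)) =
      ∑ j ∈ Finset.range L, ∑ y ∈ S, if (y + a) % 2 ^ j < gap (2 ^ L) S y then 1 else 0 := by
  have : S.image (shiftEnc L a) = (S.image fun x => (x + a) % 2 ^ L).image (bits L) := by
    rw [Finset.image_image]; rfl
  rw [this, trie_image_bits]
  · refine Finset.sum_congr rfl fun j hj => ?_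
    rw [Finset.image_image, ← card_blocks (pow_dvd_pow 2 (Finset.mem_range.1 hj).le) hS]
    rfl
  · intro x hx
    obtain ⟨y, -, rfl⟩ := Finset.mem_image.1 hx
    exact Nat.mod_lt _ (by positivity)

infix:55 " ≐ " => Expr.bin Op.eq

/-! ### The predecessor table -/

/-- Writes the offset `i * (2 * u)` of the part of the table of the `i`-th set next to each of its
elements. -/
def expandCmd : Cmd :=
  .while (.reg 22 ⊏ .reg 21)
    (.ite (.reg 23 ⊏ .reg 24)
      (.store 8 (.reg 23) (.reg 22 ⊠ (.reg 20 ⊠ .const 2)) ;; 23 ::= .reg 23 ⊞ .const 1)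
      (22 ::= .reg 22 ⊞ .const 1 ;; 24 ::= .reg 24 ⊞ .load 0 (.reg 22)))

/-- A single loop serves both the sets and their elements, so that the time is linear in `N + n`: each
iteration either handles an element or passes to the next set. -/
theorem expandCmd_runs {w n u N : ℕ} {sz o : ℕ → ℕ} {σ : State}
    (h20 : σ.reg 20 = u) (h21 : σ.reg 21 = n) (h22 : σ.reg 22 = 0) (h23 : σ.reg 23 = 0)
    (h24 : σ.reg 24 = sz 0) (hsz : ∀ i, σ.mem 0 i = sz i) (hsz0 : ∀ i, n ≤ i → sz i = 0)
    (hN : N = ∑ i ∈ Finset.range n, sz i)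
    (ho : ∀ i k, ∑ i' ∈ Finset.range i, sz i' ≤ k → k < ∑ i' ∈ Finset.range (i + 1), sz i' →
      o k = i) (hw : (n + 1) * (2 * u) < 2 ^ w) (hNw : N + n + 3 < 2 ^ w) :
    Runs w expandCmd σ ((N + n) * 30 + 4) fun τ => τ.reg 23 = N ∧
      ∀ k < N, τ.mem 8 k = o k * (2 * u) := by
  have e1 : 1 % 2 ^ w = 1 := Nat.mod_eq_of_lt (by omega)
  have e2 : 2 % 2 ^ w = 2 := Nat.mod_eq_of_lt (by omega)
  have mono : ∀ i ≤ n, ∑ i' ∈ Finset.range i, sz i' ≤ N := fun i hi => by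
    rw [hN]
    exact Finset.sum_le_sum_of_subset (Finset.range_subset_range.2 hi)
  refine (Runs.while_of_invariant (T := 26) (fun m τ => ∃ i pos,
    i ≤ n ∧ pos ≤ N ∧ ∑ i' ∈ Finset.range i, sz i' ≤ pos ∧
    pos ≤ ∑ i' ∈ Finset.range (i + 1), sz i' ∧
    m = (N - pos) + (n - i) ∧ τ.reg 20 = u ∧ τ.reg 21 = n ∧ τ.reg 22 = i ∧ τ.reg 23 = pos ∧
    τ.reg 24 = ∑ i' ∈ Finset.range (i + 1), sz i' ∧ (∀ i, τ.mem 0 i = sz i) ∧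
    ∀ k < pos, τ.mem 8 k = o k * (2 * u)) ?_ (N + n) σ ?_).mono
      (by simp only [Expr.cost]; omega) fun _ => id
  · rintro m τ ⟨i, pos, hi, hp, hp₁, hp₂, hm, t20, t21, t22, t23, t24, t0, t8⟩
    rcases hi.eq_or_lt with rfl | hlt
    · rw [← hN] at hp₁
      obtain rfl : pos = N := by omega
      exact .inl ⟨by simp [Expr.eval, Op.apply, t21, t22], t23, t8⟩
    · refine .inr ⟨by simp [Expr.eval, Op.apply, t21, t22, hlt, e1], m - 1, by omega,
        Runs.of_step rfl (by decide) ?_⟩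
      have hsucc := mono (i + 1) hlt
      rcases hp₂.eq_or_lt with hpe | hplt
      · have e3 : (∑ i' ∈ Finset.range (i + 1), sz i' + sz (i + 1)) % 2 ^ w =
            ∑ i' ∈ Finset.range (i + 1 + 1), sz i' := by
          rw [Finset.sum_range_succ _ (i + 1), Nat.mod_eq_of_lt]
          rcases (Nat.succ_le_of_lt hlt).eq_or_lt with h | h
          · rw [hsz0 (i + 1) h.ge]; omega
          · have := mono _ (Nat.succ_le_of_lt h)
            rw [Finset.sum_range_succ _ (i + 1)] at this
            omega
        refine ⟨i + 1, pos, hlt, hp, hpe.ge, ?_, by omega, ?_⟩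
        · rw [Finset.sum_range_succ _ (i + 1)]; omega
        · have e4 : (i + 1) % 2 ^ w = i + 1 := Nat.mod_eq_of_lt (by omega)
          simp [Cmd.step, Expr.eval, Op.apply, t20, t21, t22, t23, t24, hpe, e1, e4, t0, e3]
          intro k hk
          exact t8 k (by omega)
      · have hui : i * (2 * u) ≤ (n + 1) * (2 * u) := Nat.mul_le_mul_right _ (by omega)
        have hu1 : 1 * (2 * u) ≤ (n + 1) * (2 * u) := Nat.mul_le_mul_right _ (by omega)
        have e3 : (u * 2) % 2 ^ w = 2 * u := by rw [Nat.mod_eq_of_lt] <;> omega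
        refine ⟨i, pos + 1, hi, by omega, by omega, by omega, by omega, ?_⟩
        have e4 : (pos + 1) % 2 ^ w = pos + 1 := Nat.mod_eq_of_lt (by omega)
        have e5 : (i * (2 * u)) % 2 ^ w = i * (2 * u) := Nat.mod_eq_of_lt (by omega)
        simp [Cmd.step, Expr.eval, Op.apply, t20, t21, t22, t23, t24, hplt, e1, e2, e3, e4, e5, t0]
        intro k hk
        split_ifs with h
        · rw [h, ho i pos hp₁ hplt]
        · exact t8 k (by omega)
  · exact ⟨0, 0, by omega, by omega, by simp, by simp, by omega, h20, h21, h22, h23, by simp [h24],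
      hsz, fun k hk => absurd hk (by omega)⟩

/-- Loads the element number `r27`, the offset of the table of its set, and its leaf. -/
def loadCmd : Cmd :=
  28 ::= .load 1 (.reg 27) ;; 29 ::= .load 8 (.reg 27) ;; 25 ::= .reg 20 ⊞ .reg 28

/-- Enters the element `r28` into all cells on the way from its leaf to the root. Elements are stored
plus one, as an empty cell holds `0`. -/
def climbInsert : Cmd :=
  .while (.const 0 ⊏ .reg 25)
    (.ite (.load 7 (.reg 29 ⊞ .reg 25) ⊏ (.reg 28 ⊞ .const 1))
      (.store 7 (.reg 29 ⊞ .reg 25) (.reg 28 ⊞ .const 1)) .skip ;;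
    25 ::= .reg 25 ⊘ .const 2)

/-- Enters all elements into the table. -/
def insertCmd : Cmd :=
  27 ::= .const 0 ;;
  .while (.reg 27 ⊏ .reg 26) (loadCmd ;; climbInsert ;; 27 ::= .reg 27 ⊞ .const 1)

/-- The cell of the table for the set number `o` and the node `j` levels above the leaf of `x`. The
nodes of the tree with `u` leaves are numbered as in a heap: the root is `1`, the leaf number `x` is
`u + x`, and the parent of `v` is `v / 2`. -/
def cell (u o x j : ℕ) : ℕ := o * (2 * u) + (u + x) / 2 ^ j

theorem cell_lt {u n o x j : ℕ} (ho : o < n) (hx : x < u) : cell u o x j < n * (2 * u) := by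
  have h₁ : (u + x) / 2 ^ j ≤ u + x := Nat.div_le_self _ _
  have h₂ : (o + 1) * (2 * u) ≤ n * (2 * u) := Nat.mul_le_mul_right _ ho
  rw [Nat.succ_mul] at h₂
  unfold cell
  omega

theorem leaf_div {L x j : ℕ} (hj : j ≤ L) :
    (2 ^ L + x) / 2 ^ j = 2 ^ (L - j) + x / 2 ^ j := by
  rw [show 2 ^ L = 2 ^ j * 2 ^ (L - j) by rw [← pow_add]; congr 1; omega,
    Nat.mul_add_div (by positivity)]

theorem div_lt_pow_sub {L x j : ℕ} (hj : j ≤ L) (hx : x < 2 ^ L) : x / 2 ^ j < 2 ^ (L - j) := by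
  rw [Nat.div_lt_iff_lt_mul (by positivity), ← pow_add, Nat.sub_add_cancel hj]
  exact hx

/-- The node number of a heap determines the level and the position in the level. -/
theorem heap_inj {a b p q : ℕ} (hp : p < 2 ^ a) (hq : q < 2 ^ b) (h : 2 ^ a + p = 2 ^ b + q) :
    a = b ∧ p = q := by
  have key : ∀ {a b p q : ℕ}, p < 2 ^ a → 2 ^ a + p = 2 ^ b + q → ¬ a < b := by
    intro a b p q hp h hab
    have : 2 ^ (a + 1) ≤ 2 ^ b := Nat.pow_le_pow_right (by omega) hab
    rw [pow_succ] at this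
    omega
  obtain rfl : a = b := by
    have := key hp h; have := key hq h.symm; omega
  exact ⟨rfl, by omega⟩

/-- The table `T` holds, for every set and every block that contains one of its first `m` elements,
the maximum of these elements plus one. -/
def IsTable (L m : ℕ) (o x : ℕ → ℕ) (T : ℕ → ℕ) : Prop :=
  (∀ k < m, ∀ j ≤ L, x k + 1 ≤ T (cell (2 ^ L) (o k) (x k) j)) ∧
  ∀ t, T t ≠ 0 → ∃ k < m, ∃ j ≤ L, t = cell (2 ^ L) (o k) (x k) j ∧ T t = x k + 1

theorem climbInsert_runs {w L m b : ℕ} {o x : ℕ → ℕ} {σ : State}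
    (h25 : σ.reg 25 = 2 ^ L + x m) (h28 : σ.reg 28 = x m) (h29 : σ.reg 29 = o m * (2 * 2 ^ L))
    (hx : x m < 2 ^ L) (hb : ∀ j ≤ L, cell (2 ^ L) (o m) (x m) j ≤ b) (hw : b < 2 ^ w)
    (hLw : 2 ^ L + 2 < 2 ^ w) (hT : IsTable L m o x (σ.mem 7)) :
    Runs w climbInsert σ ((L + 1) * 30 + 4) fun τ => IsTable L (m + 1) o x (τ.mem 7) := by
  have e1 : 1 % 2 ^ w = 1 := Nat.mod_eq_of_lt (by omega)
  have e2 : 2 % 2 ^ w = 2 := Nat.mod_eq_of_lt (by omega)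
  have ex : (x m + 1) % 2 ^ w = x m + 1 := Nat.mod_eq_of_lt (by omega)
  refine (Runs.while_count (T := 26) (fun j τ => τ.reg 25 = (2 ^ L + x m) / 2 ^ j ∧
    τ.reg 28 = x m ∧ τ.reg 29 = o m * (2 * 2 ^ L) ∧
    (∀ k < m, ∀ j ≤ L, x k + 1 ≤ τ.mem 7 (cell (2 ^ L) (o k) (x k) j)) ∧
    (∀ j' < j, x m + 1 ≤ τ.mem 7 (cell (2 ^ L) (o m) (x m) j')) ∧
    ∀ t, τ.mem 7 t ≠ 0 → ∃ k < m + 1, ∃ j ≤ L, t = cell (2 ^ L) (o k) (x k) j ∧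
      τ.mem 7 t = x k + 1) (L + 1) ?_ ?_ ?_).mono (by simp only [Expr.cost]; omega) ?_
  · rintro j hj τ ⟨t25, t28, t29, q₁, q₂, q₃⟩
    have hj' : j ≤ L := by omega
    have hpos : 0 < (2 ^ L + x m) / 2 ^ j := by
      rw [leaf_div hj']
      positivity
    have e3 : (o m * (2 * 2 ^ L) + (2 ^ L + x m) / 2 ^ j) % 2 ^ w =
        cell (2 ^ L) (o m) (x m) j := Nat.mod_eq_of_lt ((hb j hj').trans_lt hw)
    have e4 : (2 ^ L + x m) / 2 ^ j / 2 % 2 ^ w = (2 ^ L + x m) / 2 ^ (j + 1) := by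
      rw [Nat.div_div_eq_div_mul, ← pow_succ, Nat.mod_eq_of_lt]
      refine lt_of_le_of_lt ?_ (show 2 ^ L < 2 ^ w by omega)
      refine Nat.div_le_of_le_mul ?_
      have : 2 ^ L * 2 ≤ 2 ^ L * 2 ^ (j + 1) :=
        Nat.mul_le_mul_left _ (by rw [pow_succ]; have : 0 < 2 ^ j := by positivity
                                  omega)
      rw [Nat.mul_comm (2 ^ (j + 1))]
      omega
    refine ⟨by simp [Expr.eval, Op.apply, t25, hpos, e1], Runs.of_step rfl (by decide) ?_⟩
    by_cases hlt : τ.mem 7 (cell (2 ^ L) (o m) (x m) j) < x m + 1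
    · simp only [Cmd.step, Expr.eval, Op.apply, t25, t28, t29, e1, e2, e3, ex, hlt, if_true,
        State.setReg_reg, State.setMem_reg, State.setReg_mem, State.setMem_mem, e4, true_and,
        one_ne_zero, if_false, Nat.reduceEqDiff]
      refine ⟨fun k hk j₁ hj₁ => ?_, fun j₁ hj₁ => ?_, fun t ht => ?_⟩
      · split_ifs with h
        · have := q₁ k hk j₁ hj₁
          rw [h] at this
          omega
        · exact q₁ k hk j₁ hj₁
      · split_ifs with h
        · exact le_rfl
        · refine q₂ j₁ (lt_of_le_of_ne (by omega) ?_)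
          rintro rfl
          exact h rfl
      · split_ifs with h
        · exact ⟨m, by omega, j, hj', h, rfl⟩
        · rw [if_neg h] at ht
          exact q₃ t ht
    · simp only [Cmd.step, Expr.eval, Op.apply, t25, t28, t29, e1, e2, e3, ex, hlt, if_false,
        State.setReg_reg, State.setReg_mem, e4, true_and, if_true, Nat.zero_mod,
        Nat.reduceEqDiff]
      refine ⟨q₁, fun j₁ hj₁ => ?_, q₃⟩
      rcases Nat.lt_succ_iff_lt_or_eq.1 hj₁ with h | rfl
      · exact q₂ j₁ h
      · omega
  · rintro τ ⟨t25, -⟩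
    have : (2 ^ L + x m) / 2 ^ (L + 1) = 0 := Nat.div_eq_of_lt (by rw [pow_succ]; omega)
    simp [Expr.eval, Op.apply, t25, this]
  · refine ⟨by simp [h25], h28, h29, hT.1, fun j hj => absurd hj (by omega), fun t ht => ?_⟩
    obtain ⟨k, hk, j, hj, h⟩ := hT.2 t ht
    exact ⟨k, by omega, j, hj, h⟩
  · rintro τ ⟨-, -, -, q₁, q₂, q₃⟩
    refine ⟨fun k hk j hj => ?_, q₃⟩
    rcases Nat.lt_succ_iff_lt_or_eq.1 hk with h | rfl
    · exact q₁ k h j hj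
    · exact q₂ j (by omega)

theorem insertCmd_runs {w L n N : ℕ} {o x : ℕ → ℕ} {σ : State}
    (h20 : σ.reg 20 = 2 ^ L) (h26 : σ.reg 26 = N) (h1 : ∀ k < N, σ.mem 1 k = x k)
    (h8 : ∀ k < N, σ.mem 8 k = o k * (2 * 2 ^ L)) (h7 : σ.mem 7 = fun _ => 0)
    (hx : ∀ k < N, x k < 2 ^ L) (ho : ∀ k < N, o k < n)
    (hw : (n + 1) * (2 * 2 ^ L) < 2 ^ w) (hNw : N + 3 < 2 ^ w) :
    Runs w insertCmd σ (N * ((L + 1) * 30 + 30) + 10) fun τ => IsTable L N o x (τ.mem 7) := by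
  have e1 : 1 % 2 ^ w = 1 := Nat.mod_eq_of_lt (by omega)
  have hLw : 1 * (2 * 2 ^ L) ≤ (n + 1) * (2 * 2 ^ L) := Nat.mul_le_mul_right _ (by omega)
  have hn : (n + 1) * (2 * 2 ^ L) = n * (2 * 2 ^ L) + 2 * 2 ^ L := Nat.succ_mul _ _
  have hL0 : 0 < 2 ^ L := by positivity
  refine (Runs.seq (T := 2) (T' := N * ((L + 1) * 30 + 30) + 4) (Runs.of_step rfl (by decide)
    ((Runs.while_count (T := (L + 1) * 30 + 26) (fun m τ => τ.reg 27 = m ∧ τ.reg 20 = 2 ^ L ∧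
      τ.reg 26 = N ∧ (∀ k < N, τ.mem 1 k = x k) ∧ (∀ k < N, τ.mem 8 k = o k * (2 * 2 ^ L)) ∧
      IsTable L m o x (τ.mem 7)) N ?_ ?_ ?_).mono ?_ ?_))).mono (by omega) fun _ => id
  · rintro m hm τ ⟨t27, t20, t26, t1, t8, t7⟩
    have hlt := hx m hm
    refine ⟨by simp [Expr.eval, Op.apply, t27, t26, hm, e1], ?_⟩
    have e2 : (2 ^ L + x m) % 2 ^ w = 2 ^ L + x m := Nat.mod_eq_of_lt (by omega)
    refine (Runs.seq (T := 12) (T' := ((L + 1) * 30 + 4) + 4) (Runs.of_step rfl (by decide)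
      (Runs.seq ?_))).mono (by omega) fun _ => id
    refine (climbInsert_runs (L := L) (m := m) (o := o) (x := x) (b := n * (2 * 2 ^ L))
      ?_ ?_ ?_ (hx m hm) (fun j _ => (cell_lt (ho m hm) (hx m hm)).le) (by omega) (by omega)
      ?_).frame.mono le_rfl ?_
    any_goals simp [loadCmd, Cmd.step, Expr.eval, Op.apply, t27, t20, t1 m hm, t8 m hm, e2]
    · exact t7
    · rintro ρ hρ rr rm
      have r27 : ρ.reg 27 = m := by rw [rr 27 (by decide)]; simp [t27]
      have e3 : (m + 1) % 2 ^ w = m + 1 := Nat.mod_eq_of_lt (by omega)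
      refine Runs.of_step rfl (by decide) ?_
      simp [Cmd.step, Expr.eval, Op.apply, r27, e1, e3]
      refine ⟨?_, ?_, ?_, ?_, hρ⟩
      · rw [rr 20 (by decide)]; simp [t20]
      · rw [rr 26 (by decide)]; simp [t26]
      · rw [rm 1 (by decide)]; exact t1
      · rw [rm 8 (by decide)]; exact t8
  · rintro τ ⟨t27, -, t26, -⟩
    simp [Expr.eval, Op.apply, t27, t26]
  · simp [Cmd.step, Expr.eval, h20, h26, h7, IsTable]
    exact ⟨h1, h8⟩
  · simp only [Expr.cost]
    rw [show 1 + 1 + 1 + 1 + ((L + 1) * 30 + 26) = (L + 1) * 30 + 30 by ring]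
  · rintro τ ⟨-, -, -, -, -, h⟩
    exact h

/-! ### Computing the gaps -/

/-- The cell of a node that is given by its level and its position in the level. -/
theorem IsTable.node {L N j p i : ℕ} {o x T : ℕ → ℕ} (hT : IsTable L N o x T)
    (hx : ∀ k < N, x k < 2 ^ L) (hj : j ≤ L) (hp : p < 2 ^ (L - j)) :
    (∀ k < N, o k = i → x k / 2 ^ j = p → x k + 1 ≤ T (i * (2 * 2 ^ L) + (2 ^ (L - j) + p))) ∧
    (T (i * (2 * 2 ^ L) + (2 ^ (L - j) + p)) ≠ 0 → ∃ k < N, o k = i ∧ x k / 2 ^ j = p ∧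
      T (i * (2 * 2 ^ L) + (2 ^ (L - j) + p)) = x k + 1) := by
  constructor
  · rintro k hk rfl rfl
    have := hT.1 k hk j hj
    rwa [cell, leaf_div hj] at this
  · intro h
    obtain ⟨k, hk, j', hj', he, ht⟩ := hT.2 _ h
    have hle : ∀ {j}, 2 ^ (L - j) ≤ 2 ^ L := fun {j} =>
      Nat.pow_le_pow_right (by omega) (Nat.sub_le _ _)
    have hq := div_lt_pow_sub hj' (hx k hk)
    rw [cell, leaf_div hj'] at he
    have h₁ : 2 ^ (L - j) + p < 2 * 2 ^ L := by have := @hle j; omega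
    have h₂ : 2 ^ (L - j') + x k / 2 ^ j' < 2 * 2 ^ L := by have := @hle j'; omega
    have hi : i = o k := by
      have := congrArg (fun z => z / (2 * 2 ^ L)) he
      rwa [Nat.mul_comm i, Nat.mul_comm (o k), Nat.mul_add_div (by omega),
        Nat.mul_add_div (by omega), Nat.div_eq_of_lt h₁, Nat.div_eq_of_lt h₂] at this
    subst hi
    obtain ⟨h₃, h₄⟩ := heap_inj hp hq (by omega)
    obtain rfl : j = j' := by omega
    exact ⟨k, hk, rfl, h₄.symm, ht⟩

theorem node_mod_two {L j : ℕ} (p : ℕ) (hj : j < L) : (2 ^ (L - j) + p) % 2 = p % 2 := by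
  rw [show L - j = (L - j - 1) + 1 by omega, pow_succ, Nat.mul_add_mod']

/-- If the climb from `x k` meets no nonempty left sibling, then `x k` is the minimum of its set and
its cyclic predecessor is the maximum, which the root of the table shows. -/
theorem gap_of_root {L N k : ℕ} {o x T : ℕ → ℕ} {S : Finset ℕ} (hT : IsTable L N o x T)
    (hx : ∀ k < N, x k < 2 ^ L) (hk : k < N) (hS : ∀ z, z ∈ S ↔ ∃ k' < N, o k' = o k ∧ x k' = z)
    (hpred : ∀ z ∈ S, z < x k → z / 2 ^ L ≠ x k / 2 ^ L) :
    x k + 1 ≤ T (o k * (2 * 2 ^ L) + 1) ∧ T (o k * (2 * 2 ^ L) + 1) ≤ 2 ^ L ∧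
      x k + 2 ^ L - (T (o k * (2 * 2 ^ L) + 1) - 1) = gap (2 ^ L) S (x k) := by
  have hnode := hT.node (i := o k) (p := 0) hx le_rfl (by simp)
  simp only [Nat.sub_self, pow_zero, Nat.add_zero] at hnode
  have hdiv : ∀ k < N, x k / 2 ^ L = 0 := fun k hk => Nat.div_eq_of_lt (hx k hk)
  have hle := hnode.1 k hk rfl (hdiv k hk)
  obtain ⟨k', hk', ho', -, ht⟩ := hnode.2 (by omega)
  have hx' := hx k' hk'
  have hxk := hx k hk
  refine ⟨hle, by omega, eq_gap (by omega) (by omega) hxk ?_ ?_ ?_⟩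
  · rw [show x k + 2 ^ L - (x k + 2 ^ L - (T (o k * (2 * 2 ^ L) + 1) - 1)) = x k' by omega,
      Nat.mod_eq_of_lt hx', hS]
    exact ⟨k', hk', ho', rfl⟩
  · intro z hz hlt
    refine absurd ?_ (hpred z hz hlt)
    rw [hdiv k hk, Nat.div_eq_of_lt (by omega)]
  · intro z hz _
    obtain ⟨k₁, hk₁, ho₁, rfl⟩ := (hS z).1 hz
    have := hnode.1 k₁ hk₁ ho₁ (hdiv k₁ hk₁)
    omega

/-- If the climb from `x k` stops at a node with a nonempty left sibling, then the predecessor of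
`x k` is the maximum below this sibling. -/
theorem gap_of_sibling {L N k j t : ℕ} {o x T : ℕ → ℕ} {S : Finset ℕ} (hT : IsTable L N o x T)
    (hx : ∀ k < N, x k < 2 ^ L) (hk : k < N) (hS : ∀ z, z ∈ S ↔ ∃ k' < N, o k' = o k ∧ x k' = z)
    (hj : j ≤ L) (hpred : ∀ z ∈ S, z < x k → z / 2 ^ j ≠ x k / 2 ^ j)
    (hodd : (2 ^ L + x k) / 2 ^ j % 2 = 1) (hroot : 1 < (2 ^ L + x k) / 2 ^ j)
    (ht : t = o k * (2 * 2 ^ L) + ((2 ^ L + x k) / 2 ^ j - 1)) (hne : T t ≠ 0) :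
    T t ≤ x k ∧ x k - (T t - 1) = gap (2 ^ L) S (x k) := by
  have hp := div_lt_pow_sub hj (hx k hk)
  rw [leaf_div hj] at hodd hroot ht
  obtain ⟨p, hpx⟩ : ∃ p, x k / 2 ^ j = p := ⟨_, rfl⟩
  rw [hpx] at hodd hroot ht hp hpred
  have hpos : 0 < p := by
    rcases hj.eq_or_lt with rfl | hlt
    · rw [Nat.sub_self, pow_zero] at hp hroot; omega
    · rw [node_mod_two p hlt] at hodd; omega
  have hnode := hT.node (i := o k) (p := p - 1) hx hj ((Nat.sub_le _ _).trans_lt hp)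
  rw [← Nat.add_sub_assoc hpos, ← ht] at hnode
  obtain ⟨k', hk', ho', hp', ht'⟩ := hnode.2 hne
  have hxk := hx k hk
  have hlt : x k' < x k := by
    by_contra hle
    have := Nat.div_le_div_right (c := 2 ^ j) (not_lt.1 hle)
    omega
  refine ⟨by omega, eq_gap (by omega) (by omega) hxk ?_ ?_ ?_⟩
  · rw [show x k + 2 ^ L - (x k - (T t - 1)) = x k' + 2 ^ L by omega, Nat.add_mod_right,
      Nat.mod_eq_of_lt (by omega), hS]
    exact ⟨k', hk', ho', rfl⟩
  · intro z hz hzx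
    -- an element between the maximum of the sibling block and `x k` would lie in one of the blocks
    by_contra hcon
    obtain ⟨k₁, hk₁, ho₁, rfl⟩ := (hS z).1 hz
    have h₁ := Nat.div_le_div_right (c := 2 ^ j) hzx.le
    have h₂ := Nat.div_le_div_right (c := 2 ^ j) (show x k' ≤ x k₁ by omega)
    have h₃ := hpred _ hz hzx
    have := hnode.1 k₁ hk₁ ho₁ (by omega)
    omega
  · intro z hz _
    by_contra hcon
    obtain ⟨k₁, hk₁, ho₁, rfl⟩ := (hS z).1 hz
    have := hx k₁ hk₁
    omega

/-- Climbs from a leaf to the first node with a nonempty left sibling, or else to the root. -/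
def climbQuery : Cmd :=
  .while ((.const 1 ⊏ .reg 25) ⊠
      ((.reg 25 ⊛ .const 2 ≐ .const 0) ⊞ (.load 7 (.reg 29 ⊞ (.reg 25 ⊟ .const 1)) ≐ .const 0)))
    (25 ::= .reg 25 ⊘ .const 2)

/-- Throughout the climb no smaller element of the set of `x k` lies in the block of `x k`. -/
theorem climbQuery_runs {w L N k b : ℕ} {o x : ℕ → ℕ} {S : Finset ℕ} {σ : State}
    (h25 : σ.reg 25 = 2 ^ L + x k) (h29 : σ.reg 29 = o k * (2 * 2 ^ L))
    (hT : IsTable L N o x (σ.mem 7)) (hx : ∀ k < N, x k < 2 ^ L) (hk : k < N)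
    (hS : ∀ z, z ∈ S ↔ ∃ k' < N, o k' = o k ∧ x k' = z)
    (hb : ∀ j ≤ L, cell (2 ^ L) (o k) (x k) j ≤ b) (hw : b < 2 ^ w) (h2w : 4 < 2 ^ w) :
    Runs w climbQuery σ (L * 30 + 30) fun τ => ∃ j ≤ L, τ.reg 25 = (2 ^ L + x k) / 2 ^ j ∧
      (∀ z ∈ S, z < x k → z / 2 ^ j ≠ x k / 2 ^ j) ∧
      ((j = L ∧ τ.reg 25 = 1) ∨ (τ.reg 25 % 2 = 1 ∧ 1 < τ.reg 25 ∧
        σ.mem 7 (o k * (2 * 2 ^ L) + (τ.reg 25 - 1)) ≠ 0)) := by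
  have e0 : 0 % 2 ^ w = 0 := Nat.zero_mod _
  have e1 : 1 % 2 ^ w = 1 := Nat.mod_eq_of_lt (by omega)
  have e2 : 2 % 2 ^ w = 2 := Nat.mod_eq_of_lt (by omega)
  have hxk := hx k hk
  refine (Runs.while_of_invariant (T := 4) (fun m τ => ∃ j ≤ L, m = L - j ∧
    τ.reg 25 = (2 ^ L + x k) / 2 ^ j ∧ τ.reg 29 = o k * (2 * 2 ^ L) ∧ τ.mem 7 = σ.mem 7 ∧
    ∀ z ∈ S, z < x k → z / 2 ^ j ≠ x k / 2 ^ j) ?_ L σ ?_).mono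
      (by simp only [Expr.cost]; omega) fun _ => id
  · rintro m τ ⟨j, hj, hm, t25, t29, t7, hpred⟩
    have hcell := hb j hj
    unfold cell at hcell
    have hpos : 0 < (2 ^ L + x k) / 2 ^ j := by
      rw [leaf_div hj]; positivity
    have hp := div_lt_pow_sub hj hxk
    set v := (2 ^ L + x k) / 2 ^ j with hv
    have e3 : (v - 1) % 2 ^ w = v - 1 := Nat.mod_eq_of_lt (by omega)
    have e4 : (o k * (2 * 2 ^ L) + (v - 1)) % 2 ^ w = o k * (2 * 2 ^ L) + (v - 1) :=
      Nat.mod_eq_of_lt (by omega)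
    have e5 : v % 2 % 2 ^ w = v % 2 := Nat.mod_eq_of_lt (by omega)
    have e6 : v / 2 % 2 ^ w = v / 2 := Nat.mod_eq_of_lt (by omega)
    have hguard : ((Expr.const 1 ⊏ Expr.reg 25) ⊠ ((Expr.reg 25 ⊛ Expr.const 2 ≐ Expr.const 0) ⊞
        (Expr.load 7 (Expr.reg 29 ⊞ (Expr.reg 25 ⊟ Expr.const 1)) ≐ Expr.const 0))).eval w τ = 0 ↔
        ¬ (1 < v ∧ (v % 2 = 0 ∨ σ.mem 7 (o k * (2 * 2 ^ L) + (v - 1)) = 0)) := by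
      simp only [Expr.eval, Op.apply, t25, t29, t7, e0, e1, e2, e3, e4, e5]
      by_cases c₁ : 1 < v <;> by_cases c₂ : v % 2 = 0 <;>
        by_cases c₃ : σ.mem 7 (o k * (2 * 2 ^ L) + (v - 1)) = 0 <;>
        simp [c₁, c₂, c₃, e1, e2]
    by_cases hc : 1 < v ∧ (v % 2 = 0 ∨ σ.mem 7 (o k * (2 * 2 ^ L) + (v - 1)) = 0)
    · have hjL : j < L := by
        refine lt_of_le_of_ne hj ?_
        rintro rfl
        have h1 := hc.1
        rw [hv, leaf_div le_rfl, Nat.div_eq_of_lt hxk, Nat.sub_self] at h1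
        simp at h1
      refine .inr ⟨fun h => hguard.1 h hc, m - 1, by omega, Runs.of_step rfl (by decide) ?_⟩
      have e7 : v / 2 = (2 ^ L + x k) / 2 ^ (j + 1) := by
        rw [hv, Nat.div_div_eq_div_mul, ← pow_succ]
      refine ⟨j + 1, hjL, by omega, ?_⟩
      simp [Cmd.step, Expr.eval, Op.apply, t25, t29, t7, e2, e6, ← e7]
      intro z hz hlt heq
      -- otherwise the element `z` would lie in the same block at level `j` or in its left sibling
      obtain ⟨k₁, hk₁, ho₁, rfl⟩ := (hS z).1 hz
      have h₁ := Nat.div_le_div_right (c := 2 ^ j) hlt.le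
      have h₂ := hpred _ hz hlt
      rw [pow_succ, ← Nat.div_div_eq_div_mul, ← Nat.div_div_eq_div_mul] at heq
      have hnode := (hT.node (i := o k) (p := x k₁ / 2 ^ j) hx hj
        (div_lt_pow_sub hj (hx k₁ hk₁))).1 k₁ hk₁ ho₁ rfl
      have hv' := hv
      rw [leaf_div hj] at hv'
      have hmod := node_mod_two (x k / 2 ^ j) hjL
      generalize x k / 2 ^ j = p at *
      generalize x k₁ / 2 ^ j = p₁ at *
      rw [show 2 ^ (L - j) + p₁ = v - 1 by omega] at hnode
      have hodd : v % 2 = 1 := by omega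
      rcases hc.2 with h | h <;> omega
    · refine .inl ⟨hguard.2 hc, j, hj, t25, hpred, ?_⟩
      rw [t25]
      by_cases h1 : 1 < v
      · exact .inr ⟨by omega, h1, fun h => hc ⟨h1, .inr h⟩⟩
      · refine .inl ⟨?_, by omega⟩
        by_contra hne
        have h2 : 2 ^ 1 ≤ 2 ^ (L - j) := Nat.pow_le_pow_right (by omega) (by omega)
        rw [hv, leaf_div hj] at h1
        generalize x k / 2 ^ j = p at *
        omega
  · refine ⟨0, by omega, by omega, by simp [h25], h29, rfl, fun z hz hlt => ?_⟩
    simp only [pow_zero, Nat.div_one]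
    exact hlt.ne

/-- Computes the gaps of all elements. -/
def gapCmd : Cmd :=
  27 ::= .const 0 ;;
  .while (.reg 27 ⊏ .reg 26)
    (loadCmd ;; climbQuery ;;
      (.ite (.const 1 ⊏ .reg 25) (30 ::= .reg 25 ⊟ .const 1) (30 ::= .const 1) ;;
        30 ::= .load 7 (.reg 29 ⊞ .reg 30) ⊟ .const 1 ;;
        .ite (.reg 30 ⊏ .reg 28) (31 ::= .reg 28 ⊟ .reg 30)
          (31 ::= (.reg 28 ⊞ .reg 20) ⊟ .reg 30) ;;
        .store 9 (.reg 27) (.reg 31) ;;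
        27 ::= .reg 27 ⊞ .const 1))

theorem gapCmd_runs {w L n N : ℕ} {o x : ℕ → ℕ} {S : ℕ → Finset ℕ} {σ : State}
    (h20 : σ.reg 20 = 2 ^ L) (h26 : σ.reg 26 = N) (h1 : ∀ k < N, σ.mem 1 k = x k)
    (h8 : ∀ k < N, σ.mem 8 k = o k * (2 * 2 ^ L)) (hT : IsTable L N o x (σ.mem 7))
    (hx : ∀ k < N, x k < 2 ^ L) (ho : ∀ k < N, o k < n)
    (hS : ∀ i z, z ∈ S i ↔ ∃ k' < N, o k' = i ∧ x k' = z)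
    (hw : (n + 1) * (2 * 2 ^ L) < 2 ^ w) (hNw : N + 4 < 2 ^ w) :
    Runs w gapCmd σ (N * (L * 30 + 100) + 10) fun τ =>
      ∀ k < N, τ.mem 9 k = gap (2 ^ L) (S (o k)) (x k) := by
  have e1 : 1 % 2 ^ w = 1 := Nat.mod_eq_of_lt (by omega)
  have hLw : 1 * (2 * 2 ^ L) ≤ (n + 1) * (2 * 2 ^ L) := Nat.mul_le_mul_right _ (by omega)
  have hn : (n + 1) * (2 * 2 ^ L) = n * (2 * 2 ^ L) + 2 * 2 ^ L := Nat.succ_mul _ _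
  have hL0 : 0 < 2 ^ L := by positivity
  refine (Runs.seq (T := 2) (T' := N * (L * 30 + 100) + 4) (Runs.of_step rfl (by decide)
    ((Runs.while_count (T := L * 30 + 96) (fun m τ => τ.reg 27 = m ∧ τ.reg 20 = 2 ^ L ∧
      τ.reg 26 = N ∧ (∀ k < N, τ.mem 1 k = x k) ∧ (∀ k < N, τ.mem 8 k = o k * (2 * 2 ^ L)) ∧
      IsTable L N o x (τ.mem 7) ∧ ∀ k < m, τ.mem 9 k = gap (2 ^ L) (S (o k)) (x k))
      N ?_ ?_ ?_).mono ?_ ?_))).mono (by omega) fun _ => id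
  · rintro m hm τ ⟨t27, t20, t26, t1, t8, t7, t9⟩
    have hlt := hx m hm
    refine ⟨by simp [Expr.eval, Op.apply, t27, t26, hm, e1], ?_⟩
    have e2 : (2 ^ L + x m) % 2 ^ w = 2 ^ L + x m := Nat.mod_eq_of_lt (by omega)
    have e2' : (x m + 2 ^ L) % 2 ^ w = x m + 2 ^ L := Nat.mod_eq_of_lt (by omega)
    refine (Runs.seq (T := 12) (T' := (L * 30 + 30) + 54) (Runs.of_step rfl (by decide)
      (Runs.seq ?_))).mono (by omega) fun _ => id
    refine (climbQuery_runs (L := L) (k := m) (o := o) (x := x) (b := n * (2 * 2 ^ L)) (N := N)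
      (S := S (o m)) ?_ ?_ ?_ hx hm (hS _) (fun j _ => (cell_lt (ho m hm) (hx m hm)).le)
      (by omega) (by omega)).frame.mono le_rfl ?_
    any_goals simp [loadCmd, Cmd.step, Expr.eval, Op.apply, t27, t20, t1 m hm, t8 m hm, e2]
    · exact t7
    · rintro ρ j hj r25 hpred hcase rr rm
      have r27 : ρ.reg 27 = m := by rw [rr 27 (by decide)]; simp [t27]
      have r28 : ρ.reg 28 = x m := by rw [rr 28 (by decide)]; simp
      have r29 : ρ.reg 29 = o m * (2 * 2 ^ L) := by rw [rr 29 (by decide)]; simp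
      have r20 : ρ.reg 20 = 2 ^ L := by rw [rr 20 (by decide)]; simp [t20]
      have r26 : ρ.reg 26 = N := by rw [rr 26 (by decide)]; simp [t26]
      have m7 : ρ.mem 7 = τ.mem 7 := rm 7 (by decide)
      have m1 : ρ.mem 1 = τ.mem 1 := rm 1 (by decide)
      have m8 : ρ.mem 8 = τ.mem 8 := rm 8 (by decide)
      have m9 : ρ.mem 9 = τ.mem 9 := rm 9 (by decide)
      have e3 : (m + 1) % 2 ^ w = m + 1 := Nat.mod_eq_of_lt (by omega)
      have hstore : ∀ k < m + 1, (if k = m then gap (2 ^ L) (S (o m)) (x m) else τ.mem 9 k) =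
          gap (2 ^ L) (S (o k)) (x k) := fun k hk => by
        split_ifs with h
        · rw [h]
        · exact t9 k (by omega)
      have s7 : ∀ (σ : State) i v, (σ.setMem 9 i v).mem 7 = σ.mem 7 := fun σ i v => by ext; simp
      have hcell := (cell_lt (j := j) (ho m hm) hlt)
      unfold cell at hcell
      rw [← r25] at hcell
      refine Runs.of_step rfl (by decide) ?_
      rcases hcase with ⟨hjL, hv⟩ | ⟨hodd, hv, hne⟩
      · obtain ⟨g₁, g₂, g₃⟩ := gap_of_root t7 hx hm (hS _) (by rwa [hjL] at hpred)
        rw [hv] at hcell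
        have a1 : (o m * (2 * 2 ^ L) + 1) % 2 ^ w = o m * (2 * 2 ^ L) + 1 :=
          Nat.mod_eq_of_lt (by omega)
        have a2 : (τ.mem 7 (o m * (2 * 2 ^ L) + 1) - 1) % 2 ^ w =
            τ.mem 7 (o m * (2 * 2 ^ L) + 1) - 1 := Nat.mod_eq_of_lt (by omega)
        have a3 : (x m + 2 ^ L - (τ.mem 7 (o m * (2 * 2 ^ L) + 1) - 1)) % 2 ^ w =
          gap (2 ^ L) (S (o m)) (x m) := by rw [Nat.mod_eq_of_lt (by omega), g₃]
        have a4 : ¬ τ.mem 7 (o m * (2 * 2 ^ L) + 1) - 1 < x m := by omega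
        simp [Cmd.step, Expr.eval, Op.apply, r27, r28, r29, r20, r26, hv, m7, m1, m8, m9, e1, e3,
          a1, a2, a3, a4, e2', s7]
        exact ⟨t1, t8, t7, fun k hk => hstore k (by omega)⟩
      · obtain ⟨g₁, g₂⟩ := gap_of_sibling t7 hx hm (hS _) hj hpred (by rw [← r25, hodd])
          (by rw [← r25]; exact hv) rfl (by rw [← r25]; exact hne)
        rw [← r25] at g₁ g₂
        obtain ⟨v, r25v⟩ : ∃ v, ρ.reg 25 = v := ⟨_, rfl⟩
        rw [r25v] at g₁ g₂ hcell hv hne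
        have a0 : (v - 1) % 2 ^ w = v - 1 := Nat.mod_eq_of_lt (by omega)
        have a1 : (o m * (2 * 2 ^ L) + (v - 1)) % 2 ^ w = o m * (2 * 2 ^ L) + (v - 1) :=
          Nat.mod_eq_of_lt (by omega)
        have a2 : (τ.mem 7 (o m * (2 * 2 ^ L) + (v - 1)) - 1) % 2 ^ w =
            τ.mem 7 (o m * (2 * 2 ^ L) + (v - 1)) - 1 := Nat.mod_eq_of_lt (by omega)
        have a3 : (x m - (τ.mem 7 (o m * (2 * 2 ^ L) + (v - 1)) - 1)) % 2 ^ w =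
          gap (2 ^ L) (S (o m)) (x m) := by rw [Nat.mod_eq_of_lt (by omega), g₂]
        have a4 : τ.mem 7 (o m * (2 * 2 ^ L) + (v - 1)) - 1 < x m := by omega
        simp [Cmd.step, Expr.eval, Op.apply, r27, r28, r29, r20, r26, r25v, hv, m7, m1, m8, m9, e1,
          e3, a0, a1, a2, a3, a4, s7]
        exact ⟨t1, t8, t7, fun k hk => hstore k (by omega)⟩
  · rintro τ ⟨t27, -, t26, -⟩
    simp [Expr.eval, Op.apply, t27, t26]
  · simp [Cmd.step, Expr.eval, h20, h26]
    exact ⟨h1, h8, hT⟩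
  · simp only [Expr.cost]
    rw [show 1 + 1 + 1 + 1 + (L * 30 + 96) = L * 30 + 100 by ring]
  · rintro τ ⟨-, -, -, -, -, -, h⟩
    exact h

/-! ### Adding up the block counts -/

/-- The shifts `a < s` that make `y` the first element of its block form a cyclic interval of length
`min g s` that starts at `-y`. -/
theorem first_in_block_interval {u s y g a b e : ℕ} (hsu : s ∣ u) (hy : y < u) (ha : a < s)
    (hb : b = (u - y) % s) (he : e = b + min g s) :
    ((if b ≤ a ∧ a < min e s then 1 else 0) + if a < e - min e s then 1 else 0) =
      if (y + a) % s < g then 1 else 0 := by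
  have hs : 0 < s := by omega
  have hbs : b < s := hb ▸ Nat.mod_lt _ hs
  obtain ⟨q, hq⟩ : s ∣ y + b := by
    have h : s ∣ (u - y) - b := hb ▸ Nat.dvd_sub_mod _
    have hle : b ≤ u - y := hb ▸ Nat.mod_le _ _
    have := Nat.dvd_sub hsu h
    rwa [show u - (u - y - b) = y + b by omega] at this
  have hmod : (y + a) % s = if b ≤ a then a - b else a + s - b := by
    split_ifs with h
    · rw [show y + a = (a - b) + s * q by omega, Nat.add_mul_mod_self_left,
        Nat.mod_eq_of_lt (by omega)]
    · obtain ⟨q, rfl⟩ : ∃ q', q = q' + 1 :=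
        Nat.exists_eq_succ_of_ne_zero (by rintro rfl; omega)
      rw [Nat.mul_succ] at hq
      rw [show y + a = (a + s - b) + s * q by omega, Nat.add_mul_mod_self_left,
        Nat.mod_eq_of_lt (by omega)]
  rw [hmod, he]
  rcases le_total g s with h | h <;> simp only [h, min_eq_left, min_eq_right] <;>
    rcases le_total (b + min g s) s with h' | h' <;>
    simp only [h, min_eq_left, min_eq_right] at h' <;>
    simp only [h', min_eq_left, min_eq_right] <;> split_ifs <;> omega

/-- Computes the start `r33` of the cyclic interval of shifts `first_in_block_interval` and its end
`r34`, which may exceed the block size `r32`; the part below `r32` becomes the first range. -/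
def intervalCmd : Cmd :=
  28 ::= .load 1 (.reg 27) ;; 31 ::= .load 9 (.reg 27) ;;
  33 ::= (.reg 20 ⊟ .reg 28) ⊛ .reg 32 ;;
  .ite (.reg 32 ⊏ .reg 31) (31 ::= .reg 32) .skip ;;
  34 ::= .reg 33 ⊞ .reg 31 ;;
  1 ::= .reg 33 ;;
  .ite (.reg 32 ⊏ .reg 34) (2 ::= .reg 32) (2 ::= .reg 34)

/-- Increments the entries of the shifts that make the element number `r27` the first one of its
block of size `r32`. -/
def elementCmd : Cmd :=
  intervalCmd ;; addCmd ;; (2 ::= .reg 34 ⊟ .reg 2 ;; 1 ::= .const 0) ;; addCmd ;;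
  27 ::= .reg 27 ⊞ .const 1

theorem intervalCmd_step {w u s k y g : ℕ} {σ : State} (h20 : σ.reg 20 = u) (h32 : σ.reg 32 = s)
    (h27 : σ.reg 27 = k) (h1 : σ.mem 1 k = y) (h9 : σ.mem 9 k = g) (hy : y < u) (hs : 0 < s)
    (hsu : s ≤ u) (hw : 2 * u < 2 ^ w) :
    ∃ τ, intervalCmd.step w σ = τ ∧ τ.mem = σ.mem ∧ (∀ r ∉ intervalCmd.regs, τ.reg r = σ.reg r) ∧
      τ.reg 1 = (u - y) % s ∧ τ.reg 34 = (u - y) % s + min g s ∧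
      τ.reg 2 = min ((u - y) % s + min g s) s := by
  have hb : (u - y) % s < s := Nat.mod_lt _ hs
  have e1 : 1 % 2 ^ w = 1 := Nat.mod_eq_of_lt (by omega)
  have e2 : (u - y) % 2 ^ w = u - y := Nat.mod_eq_of_lt (by omega)
  have e3 : (u - y) % s % 2 ^ w = (u - y) % s := Nat.mod_eq_of_lt (by omega)
  have hf : intervalCmd.loopFree = true := rfl
  obtain ⟨t, ht, -⟩ := intervalCmd.exec_step w hf σ
  refine ⟨_, rfl, ?_, ht.frame.1, ?_⟩
  · funext A
    exact ht.frame.2 A (by simp [intervalCmd, Cmd.arrs])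
  · obtain ⟨b, hb'⟩ : ∃ b, (u - y) % s = b := ⟨_, rfl⟩
    rw [hb'] at hb e3 ⊢
    have hg : min g s ≤ s := min_le_right _ _
    have e4 : (b + min g s) % 2 ^ w = b + min g s := Nat.mod_eq_of_lt (by omega)
    by_cases hgs : s < g
    · rw [min_eq_right hgs.le] at e4 ⊢
      by_cases hes : s < b + s
      · simp [intervalCmd, Cmd.step, Expr.eval, Op.apply, h20, h32, h27, h1, h9, e1, e2, e3, e4,
          hgs, hb', hes, -lt_add_iff_pos_left]
      · simp [intervalCmd, Cmd.step, Expr.eval, Op.apply, h20, h32, h27, h1, h9, e1, e2, e3, e4,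
          hgs, hb', hes, -lt_add_iff_pos_left]
        omega
    · rw [min_eq_left (not_lt.1 hgs)] at e4 ⊢
      by_cases hes : s < b + g
      · simp [intervalCmd, Cmd.step, Expr.eval, Op.apply, h20, h32, h27, h1, h9, e1, e2, e3, e4,
          hgs, hb', hes, hes.le]
      · simp [intervalCmd, Cmd.step, Expr.eval, Op.apply, h20, h32, h27, h1, h9, e2, e3, e4,
          hgs, hb', hes]
        omega

theorem elementCmd_runs {w u j k y g : ℕ} {A : ℕ → ℕ} {σ : State} (h20 : σ.reg 20 = u)
    (h32 : σ.reg 32 = 2 ^ j) (h27 : σ.reg 27 = k) (h1 : σ.mem 1 k = y) (h9 : σ.mem 9 k = g)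
    (hy : y < u) (hju : 2 ^ j ∣ u) (hw : 2 * u < 2 ^ w) (hk : k + 1 < 2 ^ w)
    (hσ : Stores σ j A) (hA : ∀ a < 2 ^ j, A a + 2 < 2 ^ w)
    (hfree : σ.reg 4 + 8 * (j + 1) ≤ 2 ^ w) :
    Runs w elementCmd σ (800 * (j + 1) + 60) fun τ =>
      Stores τ j (fun a => A a + if (y + a) % 2 ^ j < g then 1 else 0) ∧
      τ.reg 4 ≤ σ.reg 4 + 8 * (j + 1) ∧ τ.reg 27 = k + 1 := by
  have hj0 : 0 < 2 ^ j := by positivity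
  have hle : 2 ^ j ≤ u := Nat.le_of_dvd (by omega) hju
  have e1 : 1 % 2 ^ w = 1 := Nat.mod_eq_of_lt (by omega)
  obtain ⟨σ₁, hσ₁, m₁, r₁, l₁, e₁, h₁⟩ :=
    intervalCmd_step h20 h32 h27 h1 h9 hy hj0 hle hw
  have key := fun a ha => first_in_block_interval (g := g) (a := a) hju hy ha rfl rfl
  set b := (u - y) % 2 ^ j with hb
  have hb' : b < 2 ^ j := Nat.mod_lt _ hj0
  set e := b + min g (2 ^ j)
  have hg : min g (2 ^ j) ≤ 2 ^ j := min_le_right _ _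
  have he : min e (2 ^ j) ≤ 2 ^ j := min_le_right _ _
  have he' : e - min e (2 ^ j) ≤ 2 ^ j := by omega
  have hbe : b ≤ min e (2 ^ j) := le_min (by omega) hb'.le
  refine (Runs.seq (T := 40) (T' := 400 * (j + 1) + (6 + (400 * (j + 1) + 4)))
    (Runs.of_step rfl (by decide) (Runs.seq ?_))).mono (by omega) fun _ => id
  rw [hσ₁]
  have s₁ : Stores σ₁ j A := hσ.transfer (fun X _ _ => by rw [m₁]) (r₁ 3 (by decide))
    (r₁ 4 (by decide)) (r₁ 5 (by decide)) fun _ _ => rfl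
  have f₁ : σ₁.reg 4 = σ.reg 4 := r₁ 4 (by decide)
  refine ((addCmd_runs s₁ (by rw [l₁, h₁]; exact hbe) (by rw [h₁]; exact he)
    (by rw [f₁]; omega) (by omega) fun a ha => by have := hA a ha; omega).frame).mono le_rfl ?_
  rintro σ₂ ⟨⟨s₂, f₂⟩, r₂, -⟩
  refine Runs.seq (Runs.of_step rfl (by decide) (Runs.seq ?_))
  have s₃ := s₂.transfer (τ := (2 ::= .reg 34 ⊟ .reg 2 ;; 1 ::= .const 0).step w σ₂)
    (fun _ _ _ => rfl) rfl rfl rfl fun _ _ => rfl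
  have f₃ : ((2 ::= .reg 34 ⊟ .reg 2 ;; 1 ::= .const 0).step w σ₂).reg 4 = σ₂.reg 4 := rfl
  have l₃ : ((2 ::= .reg 34 ⊟ .reg 2 ;; 1 ::= .const 0).step w σ₂).reg 1 = 0 := by
    simp [Cmd.step, Expr.eval]
  have h₃ : ((2 ::= .reg 34 ⊟ .reg 2 ;; 1 ::= .const 0).step w σ₂).reg 2 =
      e - min e (2 ^ j) := by
    have : (e - min e (2 ^ j)) % 2 ^ w = e - min e (2 ^ j) := Nat.mod_eq_of_lt (by omega)
    simp [Cmd.step, Expr.eval, Op.apply, r₂ 34 (by decide), r₂ 2 (by decide), e₁, h₁, this]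
  have r₃ : ((2 ::= .reg 34 ⊟ .reg 2 ;; 1 ::= .const 0).step w σ₂).reg 27 = k := by
    rw [← h27, ← r₁ 27 (by decide), ← r₂ 27 (by decide)]; rfl
  generalize (2 ::= .reg 34 ⊟ .reg 2 ;; 1 ::= .const 0).step w σ₂ = σ₃ at *
  refine ((addCmd_runs s₃ (by rw [l₃]; omega) (by rw [h₃]; exact he') (by rw [f₃]; omega)
    (by omega) fun a ha => ?_).frame).mono le_rfl ?_
  · have := hA a ha
    split_ifs <;> omega
  · rintro σ₄ ⟨⟨s₄, f₄⟩, r₄, -⟩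
    refine Runs.of_step rfl (by decide) ⟨?_, ?_, ?_⟩
    · refine s₄.transfer (fun _ _ _ => rfl) rfl rfl rfl fun a ha => ?_
      rw [l₁, h₁, l₃, h₃, ← key a ha]
      split_ifs <;> omega
    · show σ₄.reg 4 ≤ _
      omega
    · simp [Cmd.step, Expr.eval, Op.apply, r₄ 27 (by decide), r₃, e1, Nat.mod_eq_of_lt hk]

/-- The number of the blocks of size `2 ^ j` that contain an element, as a function of the shift;
`x k` and `g k` are the elements and their gaps. -/
def blockCount (N : ℕ) (x g : ℕ → ℕ) (j a : ℕ) : ℕ :=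
  ∑ k ∈ Finset.range N, if (x k + a) % 2 ^ j < g k then 1 else 0

theorem blockCount_le (N : ℕ) (x g : ℕ → ℕ) (j a : ℕ) : blockCount N x g j a ≤ N := by
  refine (Finset.sum_le_card_nsmul _ _ 1 fun k _ => ?_).trans (by simp)
  split_ifs <;> simp

theorem blockCount_mod (N : ℕ) (x g : ℕ → ℕ) {i j : ℕ} (h : i ≤ j) (a : ℕ) :
    blockCount N x g i (a % 2 ^ j) = blockCount N x g i a := by
  refine Finset.sum_congr rfl fun k _ => ?_
  rw [Nat.add_mod, Nat.mod_mod_of_dvd _ (pow_dvd_pow 2 h), ← Nat.add_mod]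

/-- Adds the block counts for the block size `r32 = 2 ^ j` to the array of length `2 ^ j`, and then
doubles the array. -/
def levelCmd : Cmd :=
  27 ::= .const 0 ;; .while (.reg 27 ⊏ .reg 26) elementCmd ;; extCmd ;;
  32 ::= .reg 32 ⊠ .const 2

/-- Runs through the block sizes `1, 2, 4, …, u / 2`. -/
def levelsCmd : Cmd :=
  32 ::= .const 1 ;; .while (.reg 32 ⊏ .reg 20) levelCmd

theorem levelCmd_runs {w u N j F : ℕ} {x g A : ℕ → ℕ} {σ : State} (h20 : σ.reg 20 = u)
    (h32 : σ.reg 32 = 2 ^ j) (h26 : σ.reg 26 = N) (h1 : ∀ k < N, σ.mem 1 k = x k)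
    (h9 : ∀ k < N, σ.mem 9 k = g k) (hx : ∀ k < N, x k < u) (hju : 2 ^ j ∣ u)
    (hu : 0 < u) (hw : 2 * u < 2 ^ w) (hN : N + 2 < 2 ^ w) (hσ : Stores σ j A)
    (hA : ∀ a < 2 ^ j, A a + N + 2 < 2 ^ w) (hF : σ.reg 4 ≤ F)
    (hfree : F + N * (8 * (j + 1)) + 2 ≤ 2 ^ w) :
    Runs w levelCmd σ (N * (800 * (j + 1) + 64) + 60) fun τ =>
      Stores τ (j + 1) (fun a => A (a % 2 ^ j) + blockCount N x g j (a % 2 ^ j)) ∧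
      τ.reg 4 ≤ F + N * (8 * (j + 1)) + 1 ∧ τ.reg 32 = 2 ^ (j + 1) := by
  have hj0 : 0 < 2 ^ j := by positivity
  have hle : 2 ^ j ≤ u := Nat.le_of_dvd hu hju
  have hjj : j < 2 ^ j := Nat.lt_two_pow_self
  have e1 : 1 % 2 ^ w = 1 := Nat.mod_eq_of_lt (by omega)
  have e2 : 2 % 2 ^ w = 2 := Nat.mod_eq_of_lt (by omega)
  have e3 : 2 ^ j * 2 % 2 ^ w = 2 ^ (j + 1) := by
    rw [pow_succ, Nat.mod_eq_of_lt (by omega)]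
  refine (Runs.seq (T := 2) (T' := (N * (4 + (800 * (j + 1) + 60)) + 4) + (40 + 4))
    (Runs.of_step rfl (by decide) (Runs.seq ?_))).mono
      (by rw [show 4 + (800 * (j + 1) + 60) = 800 * (j + 1) + 64 by omega]; omega) fun _ => id
  refine ((Runs.while_count (T := 800 * (j + 1) + 60) (fun m τ => τ.reg 27 = m ∧
    τ.reg 20 = u ∧ τ.reg 32 = 2 ^ j ∧ τ.reg 26 = N ∧ τ.mem 1 = σ.mem 1 ∧ τ.mem 9 = σ.mem 9 ∧
    τ.reg 4 ≤ F + m * (8 * (j + 1)) ∧ Stores τ j fun a => A a + blockCount m x g j a)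
    N ?_ ?_ ?_)).mono le_rfl ?_
  · rintro m hm τ ⟨t27, t20, t32, t26, t1, t9, t4, ts⟩
    refine ⟨by simp [Expr.eval, Op.apply, t27, t26, hm, e1], ?_⟩
    have hmN : m * (8 * (j + 1)) + 8 * (j + 1) ≤ N * (8 * (j + 1)) := by
      rw [← Nat.succ_mul]
      exact Nat.mul_le_mul_right _ hm
    refine (elementCmd_runs t20 t32 t27 (by rw [t1, h1 m hm]) (by rw [t9, h9 m hm]) (hx m hm) hju
      hw (by omega) ts (fun a ha => ?_) (by omega)).frame.mono le_rfl ?_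
    · have := hA a ha
      have := blockCount_le m x g j a
      omega
    · rintro ρ ⟨⟨ρs, ρ4, ρ27⟩, rr, rm⟩
      refine ⟨ρ27, by rw [rr 20 (by decide), t20], by rw [rr 32 (by decide), t32],
        by rw [rr 26 (by decide), t26], by rw [rm 1 (by decide), t1],
        by rw [rm 9 (by decide), t9], by rw [Nat.succ_mul]; omega, ?_⟩
      refine ρs.transfer (fun _ _ _ => rfl) rfl rfl rfl fun a _ => ?_
      rw [blockCount, Finset.sum_range_succ, ← blockCount, Nat.add_assoc]
  · rintro τ ⟨t27, -, -, t26, -⟩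
    simp [Expr.eval, Op.apply, t27, t26]
  · refine ⟨by simp [Cmd.step, Expr.eval], by simp [Cmd.step, h20], by simp [Cmd.step, h32],
      by simp [Cmd.step, h26], rfl, rfl, by simpa [Cmd.step] using hF, ?_⟩
    exact hσ.transfer (fun _ _ _ => rfl) rfl rfl rfl fun a _ => by simp [blockCount]
  · rintro τ ⟨-, -, t32, -, -, -, t4, ts⟩
    refine Runs.seq ((extCmd_runs ts (by omega) (by omega)).frame.mono le_rfl ?_)
    rintro ρ ⟨⟨ρs, ρ4⟩, rr, -⟩
    refine Runs.of_step rfl (by decide) ⟨?_, ?_, ?_⟩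
    · exact ρs.transfer (fun _ _ _ => rfl) rfl rfl rfl fun _ _ => rfl
    · show ρ.reg 4 ≤ _
      omega
    · simp [Cmd.step, Expr.eval, Op.apply, rr 32 (by decide), t32, e2, e3]

theorem levelsCmd_runs {w L N : ℕ} {x g : ℕ → ℕ} {σ : State} (h20 : σ.reg 20 = 2 ^ L)
    (h26 : σ.reg 26 = N) (h1 : ∀ k < N, σ.mem 1 k = x k) (h9 : ∀ k < N, σ.mem 9 k = g k)
    (hx : ∀ k < N, x k < 2 ^ L) (hw : 2 * 2 ^ L < 2 ^ w) (hN : (L + 1) * N + 2 < 2 ^ w)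
    (hσ : Stores σ 0 fun _ => 0) (h4 : σ.reg 4 = 1)
    (hfree : (L + 1) * (N * (8 * (L + 1)) + 1) + 2 ≤ 2 ^ w) :
    Runs w levelsCmd σ (L * (N * (800 * (L + 1) + 64) + 64) + 6) fun τ =>
      Stores τ L fun a => ∑ j ∈ Finset.range L, blockCount N x g j a := by
  have e1 : 1 % 2 ^ w = 1 := Nat.mod_eq_of_lt (by omega)
  refine (Runs.seq (T := 2) (T' := L * (4 + (N * (800 * (L + 1) + 64) + 60)) + 4)
    (Runs.of_step rfl (by decide) ?_)).mono (by
      rw [show 4 + (N * (800 * (L + 1) + 64) + 60) = N * (800 * (L + 1) + 64) + 64 by omega]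
      omega) fun _ => id
  refine ((Runs.while_count (T := N * (800 * (L + 1) + 64) + 60) (fun j τ =>
    τ.reg 20 = 2 ^ L ∧ τ.reg 32 = 2 ^ j ∧ τ.reg 26 = N ∧ τ.mem 1 = σ.mem 1 ∧ τ.mem 9 = σ.mem 9 ∧
    τ.reg 4 ≤ 1 + j * (N * (8 * (L + 1)) + 1) ∧
    Stores τ j fun a => ∑ i ∈ Finset.range j, blockCount N x g i a) L ?_ ?_ ?_)).mono le_rfl ?_
  · rintro j hj τ ⟨t20, t32, t26, t1, t9, t4, ts⟩
    have hlt : 2 ^ j < 2 ^ L := Nat.pow_lt_pow_right (by omega) hj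
    refine ⟨by simp [Expr.eval, Op.apply, t20, t32, if_pos hlt, e1], ?_⟩
    have hNj : N * (8 * (j + 1)) ≤ N * (8 * (L + 1)) := Nat.mul_le_mul_left _ (by omega)
    have hNt : N * (800 * (j + 1) + 64) ≤ N * (800 * (L + 1) + 64) :=
      Nat.mul_le_mul_left _ (by omega)
    have hjL : (j + 1) * (N * (8 * (L + 1)) + 1) ≤ (L + 1) * (N * (8 * (L + 1)) + 1) :=
      Nat.mul_le_mul_right _ (by omega)
    have hNN : (j + 1) * N ≤ (L + 1) * N := Nat.mul_le_mul_right _ (by omega)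
    rw [Nat.succ_mul] at hjL hNN
    refine (levelCmd_runs t20 t32 t26 (fun k hk => by rw [t1, h1 k hk])
      (fun k hk => by rw [t9, h9 k hk]) hx (pow_dvd_pow 2 hj.le) (by positivity) hw
      (by omega) ts (fun a ha => ?_) t4 (by omega)).frame.mono
      (Nat.add_le_add_right hNt 60) ?_
    · have : ∑ i ∈ Finset.range j, blockCount N x g i a ≤ j * N := by
        refine (Finset.sum_le_card_nsmul _ _ N fun i _ => blockCount_le N x g i a).trans ?_
        simp
      omega
    · rintro ρ ⟨⟨ρs, ρ4, ρ32⟩, rr, rm⟩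
      refine ⟨by rw [rr 20 (by decide), t20], ρ32, by rw [rr 26 (by decide), t26],
        by rw [rm 1 (by decide), t1], by rw [rm 9 (by decide), t9],
        by rw [Nat.succ_mul]; omega, ?_⟩
      refine ρs.transfer (fun _ _ _ => rfl) rfl rfl rfl fun a _ => ?_
      rw [Finset.sum_range_succ, blockCount_mod N x g le_rfl]
      congr 1
      refine Finset.sum_congr rfl fun i hi => (blockCount_mod N x g ?_ a).symm
      exact (Finset.mem_range.1 hi).le
  · rintro τ ⟨t20, t32, -⟩
    simp [Expr.eval, Op.apply, t20, t32]
  · refine ⟨by simp [Cmd.step, h20], by simp [Cmd.step, Expr.eval, e1], by simp [Cmd.step, h26],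
      rfl, rfl, by simp [Cmd.step, h4], ?_⟩
    exact hσ.transfer (fun _ _ _ => rfl) rfl rfl rfl fun a _ => by simp
  · rintro τ ⟨-, -, -, -, -, -, ts⟩
    exact ts

/-! ### Concatenated listings -/

/-- The position where the listing number `i` starts in the concatenation of `ls`. -/
def offset (ls : List (List ℕ)) (i : ℕ) : ℕ :=
  ∑ i' ∈ Finset.range i, (ls.getD i' []).length

/-- The number of the listing that contains the position `k` of the concatenation. -/
def owner (ls : List (List ℕ)) (k : ℕ) : ℕ :=
  ((Finset.range ls.length).filter fun i => offset ls (i + 1) ≤ k).card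

theorem offset_succ (ls : List (List ℕ)) (i : ℕ) :
    offset ls (i + 1) = offset ls i + (ls.getD i []).length :=
  Finset.sum_range_succ _ _

theorem offset_mono (ls : List (List ℕ)) : Monotone (offset ls) :=
  monotone_nat_of_le_succ fun i => by rw [offset_succ]; omega

theorem owner_eq {ls : List (List ℕ)} {i k : ℕ} (h₁ : offset ls i ≤ k)
    (h₂ : k < offset ls (i + 1)) : owner ls k = i := by
  have hi : i < ls.length := by
    by_contra h
    rw [offset_succ, List.getD_eq_default _ _ (by omega)] at h₂
    simp at h₂
    omega
  have : ((Finset.range ls.length).filter fun i => offset ls (i + 1) ≤ k) = Finset.range i := by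
    ext j
    simp only [Finset.mem_filter, Finset.mem_range]
    constructor
    · rintro ⟨-, hj⟩
      by_contra hij
      have := offset_mono ls (show i + 1 ≤ j + 1 by omega)
      omega
    · intro hj
      exact ⟨by omega, (offset_mono ls hj).trans h₁⟩
  rw [owner, this, Finset.card_range]

theorem exists_eq_offset_add {ls : List (List ℕ)} {m k : ℕ} (h : k < offset ls m) :
    ∃ i < m, ∃ j < (ls.getD i []).length, k = offset ls i + j := by
  induction m with
  | zero => simp [offset] at h
  | succ m ih =>
    rcases lt_or_ge k (offset ls m) with hk | hk
    · obtain ⟨i, hi, r⟩ := ih hk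
      exact ⟨i, by omega, r⟩
    · rw [offset_succ] at h
      exact ⟨m, by omega, k - offset ls m, by omega, by omega⟩

theorem owner_offset_add {ls : List (List ℕ)} {i j : ℕ} (hj : j < (ls.getD i []).length) :
    owner ls (offset ls i + j) = i :=
  owner_eq (by omega) (by rw [offset_succ]; omega)

theorem getD_flatten {ls : List (List ℕ)} {i j : ℕ} (hj : j < (ls.getD i []).length) :
    ls.flatten.getD (offset ls i + j) 0 = (ls.getD i []).getD j 0 := by
  induction ls generalizing i with
  | nil => simp at hj
  | cons l ls ih =>
    cases i with
    | zero =>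
      simp only [List.getD_cons_zero] at hj ⊢
      rw [List.flatten_cons, offset, Finset.range_zero, Finset.sum_empty, Nat.zero_add,
        List.getD_append _ _ _ _ hj]
    | succ i =>
      simp only [List.getD_cons_succ] at hj ⊢
      rw [← ih hj, List.flatten_cons, offset, Finset.sum_range_succ']
      simp only [List.getD_cons_succ, List.getD_cons_zero]
      rw [List.getD_append_right _ _ _ _ (by omega)]
      congr 1
      unfold offset
      omega

theorem sum_range_getD (l : List ℕ) (f : ℕ → ℕ) :
    ∑ j ∈ Finset.range l.length, f (l.getD j 0) = (l.map f).sum := by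
  induction l with
  | nil => simp
  | cons x l ih =>
    rw [List.length_cons, Finset.sum_range_succ']
    simp only [List.getD_cons_succ, List.getD_cons_zero, List.map_cons, List.sum_cons]
    rw [ih, Nat.add_comm]

theorem sum_range_offset (ls : List (List ℕ)) (hls : ∀ i, (ls.getD i []).Nodup)
    (f : ℕ → ℕ → ℕ) (m : ℕ) :
    ∑ k ∈ Finset.range (offset ls m), f (owner ls k) (ls.flatten.getD k 0) =
      ∑ i ∈ Finset.range m, ∑ y ∈ (ls.getD i []).toFinset, f i y := by
  induction m with
  | zero => simp [offset]
  | succ m ih =>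
    rw [offset_succ, Finset.sum_range_add, ih, Finset.sum_range_succ]
    congr 1
    rw [List.sum_toFinset _ (hls m), ← sum_range_getD]
    refine Finset.sum_congr rfl fun j hj => ?_
    rw [owner_offset_add (Finset.mem_range.1 hj), getD_flatten (Finset.mem_range.1 hj)]

theorem getD_ofFn {n : ℕ} (l : Fin n → List ℕ) (i : ℕ) :
    (List.ofFn l).getD i [] = if h : i < n then l ⟨i, h⟩ else [] := by
  split_ifs with h
  · rw [List.getD_eq_getElem _ _ (by simpa using h), List.getElem_ofFn]
  · rw [List.getD_eq_default _ _ (by simpa using h)]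

/-! ### The optimal shift -/

/-- The program for the optimal shift. Without any elements it stops at once, as the time for the
`L` levels would not be covered by the bound then. -/
def shiftCmd : Cmd :=
  (20 ::= .reg 1 ;; 21 ::= .reg 2 ;; 24 ::= .load 0 (.const 0)) ;; expandCmd ;;
  26 ::= .reg 23 ;;
  .ite (.const 0 ⊏ .reg 26)
    (insertCmd ;; gapCmd ;; initCmd ;; levelsCmd ;; argCmd)
    (0 ::= .const 0)

/-- The array that the levels add up to is the shifted trie measure. -/
theorem shiftTrie_eq {L n : ℕ} {S : Fin n → Finset ℕ} {l : Fin n → List ℕ}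
    (hS : ∀ i, ∀ x ∈ S i, x < 2 ^ L) (hl : ∀ i, (l i).Nodup ∧ (l i).toFinset = S i) (a : ℕ) :
    shiftTrie L S a = ∑ j ∈ Finset.range L, blockCount (offset (List.ofFn l) n)
      (fun k => (List.ofFn l).flatten.getD k 0)
      (fun k => gap (2 ^ L) ((List.ofFn l).getD (owner (List.ofFn l) k) []).toFinset
        ((List.ofFn l).flatten.getD k 0)) j a := by
  have hnd : ∀ i, ((List.ofFn l).getD i []).Nodup := fun i => by
    rw [getD_ofFn]
    split_ifs
    · exact (hl _).1
    · exact List.nodup_nil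
  rw [shiftTrie, Finset.sum_congr rfl fun i _ => trie_image_shiftEnc L a (S i) (hS i),
    Finset.sum_comm]
  refine Finset.sum_congr rfl fun j _ => ?_
  rw [blockCount, sum_range_offset _ hnd fun i y =>
    if (y + a) % 2 ^ j < gap (2 ^ L) ((List.ofFn l).getD i []).toFinset y then 1 else 0,
    Finset.sum_range]
  refine Finset.sum_congr rfl fun i _ => ?_
  rw [getD_ofFn, dif_pos i.2, (hl _).2]

theorem shiftCmd_runs {L n N w : ℕ} {S : Fin n → Finset ℕ} {l : Fin n → List ℕ}
    (hS : ∀ i, ∀ x ∈ S i, x < 2 ^ L) (hl : ∀ i, (l i).Nodup ∧ (l i).toFinset = S i)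
    (hN : ∑ i, (S i).card = N) (hw : (2 ^ L + n + N + 1) ^ 8 ≤ 2 ^ w) :
    Runs w shiftCmd (inputState L l) ((N + n) * 30 + (if N = 0 then 30 else
        N * ((L + 1) * 30 + 30) + N * (L * 30 + 100) +
          L * (N * (800 * (L + 1) + 64) + 64) + 80)) fun τ =>
      τ.reg 0 < 2 ^ L ∧ (∀ b < 2 ^ L, shiftTrie L S (τ.reg 0) ≤ shiftTrie L S b) ∧
      (N ≠ 0 → Stores τ L (shiftTrie L S) ∧ τ.reg 0 = τ.mem argminArr (τ.reg 3)) := by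
  set ls := List.ofFn l with hls
  have hlen : ∀ i : Fin n, (l i).length = (S i).card := fun i => by
    rw [← (hl i).2, List.toFinset_card_of_nodup (hl i).1]
  have hoff : offset ls n = N := by
    rw [offset, Finset.sum_range, ← hN]
    refine Finset.sum_congr rfl fun i _ => ?_
    rw [hls, getD_ofFn, dif_pos i.2, hlen]
  have hmem : ∀ i z, z ∈ (ls.getD i []).toFinset ↔
      ∃ k < N, owner ls k = i ∧ ls.flatten.getD k 0 = z := by
    intro i z
    rw [List.mem_toFinset]
    constructor
    · intro hz
      obtain ⟨j, hj, rfl⟩ := List.getElem_of_mem hz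
      have hi : i < n := by
        by_contra h
        rw [hls, getD_ofFn, dif_neg h] at hj
        simp at hj
      have h₁ : offset ls i + j < offset ls (i + 1) := by rw [offset_succ]; omega
      refine ⟨offset ls i + j, ?_, owner_offset_add hj, ?_⟩
      · rw [← hoff]
        exact h₁.trans_le (offset_mono ls hi)
      · rw [getD_flatten hj, List.getD_eq_getElem _ _ hj]
    · rintro ⟨k, hk, rfl, rfl⟩
      rw [← hoff] at hk
      obtain ⟨i, -, j, hj, rfl⟩ := exists_eq_offset_add hk
      rw [owner_offset_add hj, getD_flatten hj, List.getD_eq_getElem _ _ hj]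
      exact List.getElem_mem hj
  have hown : ∀ k < N, owner ls k < n := fun k hk => by
    rw [← hoff] at hk
    obtain ⟨i, hi, j, hj, rfl⟩ := exists_eq_offset_add hk
    rwa [owner_offset_add hj]
  have hx : ∀ k < N, ls.flatten.getD k 0 < 2 ^ L := fun k hk => by
    have h := (hmem _ _).2 ⟨k, hk, rfl, rfl⟩
    rw [hls, getD_ofFn, dif_pos (hown k hk), (hl _).2] at h
    exact hS _ _ h
  -- the words are long enough
  have hL : L < 2 ^ L := Nat.lt_two_pow_self
  obtain ⟨M, hM⟩ : ∃ M, M = 2 ^ L + n + N + 1 := ⟨_, rfl⟩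
  have hM2 : 2 ≤ M := by omega
  have hM₂ : 2 * M ≤ M * M := Nat.mul_le_mul_right _ hM2
  have hM₃ : 2 * (M * M) ≤ M * (M * M) := Nat.mul_le_mul_right _ hM2
  have hM₈ : 32 * (M * (M * M)) ≤ 2 ^ w := by
    rw [← hM] at hw
    refine le_trans ?_ hw
    rw [show M ^ 8 = M ^ 5 * (M * (M * M)) by ring]
    exact Nat.mul_le_mul_right _ (le_trans (by norm_num) (Nat.pow_le_pow_left hM2 5))
  have w₁ : (n + 1) * (2 * 2 ^ L) ≤ M * (2 * M) := Nat.mul_le_mul (by omega) (by omega)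
  have w₂ : (L + 1) * N ≤ M * M := Nat.mul_le_mul (by omega) (by omega)
  have w₃ : (L + 1) * (N * (8 * (L + 1)) + 1) ≤ M * (M * (8 * M) + 1) :=
    Nat.mul_le_mul (by omega) (Nat.add_le_add_right (Nat.mul_le_mul (by omega) (by omega)) 1)
  rw [show M * (2 * M) = 2 * (M * M) by ring] at w₁
  rw [show M * (M * (8 * M) + 1) = 8 * (M * (M * M)) + M by ring] at w₃
  have e0 : 0 % 2 ^ w = 0 := Nat.zero_mod _
  have e1 : 1 % 2 ^ w = 1 := Nat.mod_eq_of_lt (by omega)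
  obtain ⟨T, hT⟩ : ∃ T, T = (if N = 0 then 2 else
      N * ((L + 1) * 30 + 30) + N * (L * 30 + 100) +
        L * (N * (800 * (L + 1) + 64) + 64) + 44) := ⟨_, rfl⟩
  refine (Runs.seq (T := 8) (T' := ((N + n) * 30 + 4) + (2 + (4 + T)))
    (Runs.of_step rfl (by decide) (Runs.seq ?_))).mono (by rw [hT]; split_ifs <;> omega)
      fun _ => id
  refine ((expandCmd_runs (n := n) (u := 2 ^ L) (N := N) (o := owner ls)
    (sz := fun i => (ls.getD i []).length) ?_ ?_ ?_ ?_ ?_ ?_ ?_ hoff.symm ?_ (by omega)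
    (by omega)).frame).mono le_rfl ?_
  · simp [Cmd.step, Expr.eval, inputState]
  · simp [Cmd.step, Expr.eval, inputState]
  · simp [Cmd.step, inputState]
  · simp [Cmd.step, inputState]
  · simp only [Cmd.step, Expr.eval, inputState, State.setReg_reg, State.setReg_mem, if_true, e0,
      hls, getD_ofFn]
    split_ifs <;> rfl
  · intro i
    simp only [Cmd.step, inputState, State.setReg_mem, if_true, hls, getD_ofFn]
    split_ifs <;> rfl
  · intro i hi
    simp only [hls, getD_ofFn, dif_neg (not_lt.2 hi), List.length_nil]
  · exact fun i k h₁ h₂ => owner_eq h₁ h₂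
  rintro σ₁ ⟨⟨t23, t8⟩, tr, tm⟩
  have t20 : σ₁.reg 20 = 2 ^ L := by
    rw [tr 20 (by decide)]; simp [Cmd.step, Expr.eval, inputState]
  have t7 : σ₁.mem 7 = fun _ => 0 := by
    rw [tm 7 (by decide)]; simp [Cmd.step, inputState]
  have t1 : ∀ k, σ₁.mem 1 k = ls.flatten.getD k 0 := fun k => by
    rw [tm 1 (by decide)]; simp [Cmd.step, inputState, hls]
  refine Runs.seq (Runs.of_step rfl (by decide) ?_)
  have hset : ∀ r, r ≠ 26 → ((26 ::= Expr.reg 23).step w σ₁).reg r = σ₁.reg r := fun r hr => by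
    simp [Cmd.step, hr]
  have u26 : ((26 ::= Expr.reg 23).step w σ₁).reg 26 = N := by simp [Cmd.step, Expr.eval, t23]
  have hsetm : ((26 ::= Expr.reg 23).step w σ₁).mem = σ₁.mem := rfl
  generalize (26 ::= Expr.reg 23).step w σ₁ = σ₂ at hset hsetm u26 ⊢
  rw [← hset 20 (by decide)] at t20
  rw [← hsetm] at t7 t1 t8
  refine Runs.ite (T := T) (fun hb => ?_) (fun hb => ?_)
  swap
  · have hN0 : N = 0 := by
      by_contra h
      simp [Expr.eval, Op.apply, u26, Nat.pos_of_ne_zero h, e1] at hb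
    refine Runs.of_step rfl (by rw [hT, if_pos hN0]; decide)
      ⟨by simp [Cmd.step, Expr.eval], fun b _ => ?_, fun h => absurd hN0 h⟩
    rw [shiftTrie_eq hS hl, ← hls, hoff, hN0]
    simp [blockCount]
  have hN0 : N ≠ 0 := by
    rintro rfl
    simp [Expr.eval, Op.apply, u26] at hb
  rw [if_neg hN0] at hT
  refine (Runs.seq (T := N * ((L + 1) * 30 + 30) + 10) (T' := (N * (L * 30 + 100) + 10) + (15 +
    ((L * (N * (800 * (L + 1) + 64) + 64) + 6) + 3))) ?_).mono (by omega) fun _ => id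
  refine (insertCmd_runs (n := n) (o := owner ls) t20 u26 (fun k _ => t1 k) t8 t7 hx hown
    (by omega) (by omega)).frame.mono le_rfl ?_
  rintro σ₃ ⟨hT₃, r₃, m₃⟩
  refine Runs.seq ((gapCmd_runs (n := n) (o := owner ls)
    (S := fun i => (ls.getD i []).toFinset) (by rw [r₃ 20 (by decide), t20])
    (by rw [r₃ 26 (by decide), u26]) (fun k _ => by rw [m₃ 1 (by decide), t1 k])
    (fun k hk => by rw [m₃ 8 (by decide), t8 k hk]) hT₃ hx hown hmem (by omega)
    (by omega)).frame.mono le_rfl ?_)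
  rintro σ₄ ⟨h9, r₄, m₄⟩
  refine Runs.seq ((initCmd_runs (by omega) σ₄).frame.mono le_rfl ?_)
  rintro σ₅ ⟨⟨s₅, f₅⟩, r₅, m₅⟩
  refine Runs.seq ((levelsCmd_runs (L := L) (N := N) (x := fun k => ls.flatten.getD k 0)
    (g := fun k => gap (2 ^ L) (ls.getD (owner ls k) []).toFinset (ls.flatten.getD k 0))
    (by rw [r₅ 20 (by decide), r₄ 20 (by decide), r₃ 20 (by decide), t20])
    (by rw [r₅ 26 (by decide), r₄ 26 (by decide), r₃ 26 (by decide), u26])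
    (fun k _ => by rw [m₅ 1 (by decide), m₄ 1 (by decide), m₃ 1 (by decide), t1 k])
    (fun k hk => by rw [m₅ 9 (by decide), h9 k hk]) hx (by omega) (by omega) s₅ f₅
    (by omega)).mono le_rfl ?_)
  intro σ₆ s₆
  have hA : (fun a => ∑ j ∈ Finset.range L, blockCount N (fun k => ls.flatten.getD k 0)
      (fun k => gap (2 ^ L) (ls.getD (owner ls k) []).toFinset (ls.flatten.getD k 0)) j a) =
      shiftTrie L S := by
    funext a
    rw [shiftTrie_eq hS hl, ← hls, hoff]
  rw [hA] at s₆
  refine (argCmd_runs s₆).mono le_rfl ?_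
  rintro τ ⟨h₁, -, h₃, h₄, h₅, h₆, h₇⟩
  exact ⟨h₆, h₇, fun _ => ⟨h₁, by rw [h₅, h₃, h₄]⟩⟩

theorem time_le {L N n : ℕ} (hL : 1 ≤ L) (hN : 1 ≤ N) :
    (N + n) * 30 + (N * ((L + 1) * 30 + 30) + N * (L * 30 + 100) +
      L * (N * (800 * (L + 1) + 64) + 64) + 80) ≤ 2060 * (N * L ^ 2) + 30 * n := by
  have h₁ : N * L * 1 ≤ N * L * L := Nat.mul_le_mul_left _ hL
  have h₂ : N * 1 ≤ N * L := Nat.mul_le_mul_left _ hL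
  have h₃ : 1 * L ≤ N * L := Nat.mul_le_mul_right _ hN
  have e₁ : N * ((L + 1) * 30 + 30) = 30 * (N * L) + 60 * N := by ring
  have e₂ : N * (L * 30 + 100) = 30 * (N * L) + 100 * N := by ring
  have e₃ : L * (N * (800 * (L + 1) + 64) + 64) = 800 * (N * L * L) + 864 * (N * L) + 64 * L := by
    ring
  rw [e₁, e₂, e₃, show N * L ^ 2 = N * L * L by ring]
  omega

end ShiftTrie

theorem mainTheorem2 :
    ∃ (C c : ℕ) (cInit cAdd cExt cArg P : ShiftTrie.Cmd),
      ShiftTrie.Implements C cInit cAdd cExt cArg ∧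
      ∀ (L n : ℕ) (S : Fin n → Finset ℕ) (l : Fin n → List ℕ),
        (∀ i, ∀ x ∈ S i, x < 2 ^ L) →
        (∀ i, (l i).Nodup ∧ (l i).toFinset = S i) →
        ∀ w : ℕ, (2 ^ L + n + (∑ i, (S i).card) + 1) ^ c ≤ 2 ^ w →
          ∃ (t : ℕ) (τ : ShiftTrie.State),
            ShiftTrie.Exec w P (ShiftTrie.inputState L l) t τ ∧
            τ.reg ShiftTrie.outReg < 2 ^ L ∧
            (∀ b < 2 ^ L,
              ShiftTrie.shiftTrie L S (τ.reg ShiftTrie.outReg) ≤ ShiftTrie.shiftTrie L S b) ∧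
            t ≤ C * ((∑ i, (S i).card) * L ^ 2 + n + 1) ∧
            (1 ≤ L → 1 ≤ n → (∀ i, (S i).Nonempty) →
              t ≤ C * ((∑ i, (S i).card) * L ^ 2) ∧
              ShiftTrie.Stores τ L (ShiftTrie.shiftTrie L S) ∧
              τ.reg ShiftTrie.outReg =
                τ.mem ShiftTrie.argminArr (τ.reg ShiftTrie.rootReg)) := by
  refine ⟨2500, 8, ShiftTrie.initCmd, ShiftTrie.addCmd, ShiftTrie.extCmd, ShiftTrie.argCmd,
    ShiftTrie.shiftCmd, ShiftTrie.implements (by norm_num), ?_⟩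
  intro L n S l hS hl w hw
  obtain ⟨N, hN⟩ : ∃ N, ∑ i, (S i).card = N := ⟨_, rfl⟩
  rw [hN] at hw ⊢
  obtain ⟨t, τ, he, ht, h₁, h₂, h₃⟩ := ShiftTrie.shiftCmd_runs hS hl hN hw
  refine ⟨t, τ, he, h₁, h₂, ?_, fun hL hn hne => ?_⟩
  · rcases Nat.eq_zero_or_pos N with rfl | hN0
    · rw [if_pos rfl] at ht
      omega
    rw [if_neg hN0.ne'] at ht
    rcases Nat.eq_zero_or_pos L with rfl | hL
    · -- a universe with one element: every set has at most one element
      have hNn : N ≤ n := by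
        rw [← hN]
        refine (Finset.sum_le_card_nsmul _ _ 1 fun i _ => ?_).trans (by simp)
        refine Finset.card_le_one.2 fun x hx y hy => ?_
        have := hS i x hx
        have := hS i y hy
        omega
      omega
    · have := ShiftTrie.time_le (n := n) hL hN0
      omega
  · have hnN : n ≤ N := by
      rw [← hN]
      simpa using Finset.card_nsmul_le_sum Finset.univ (fun i => (S i).card) 1
        fun i _ => (hne i).card_pos
    rw [if_neg (by omega)] at ht
    have := ShiftTrie.time_le (n := n) hL (hn.trans hnN)
    have hNL : N * 1 ≤ N * L ^ 2 := Nat.mul_le_mul_left _ (Nat.one_le_pow _ _ hL)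
    exact ⟨by omega, h₃ (by omega)⟩
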